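/- Let $B^H=(B^H_t)_{t\ge 0}$, $H\in[1/2,1]$, be fractional Brownian motions with Hurst index $H$, i.e. centered Gaussian processes with almost surely continuous paths and $$\mathsf E\,B^H_tB^H_s=\tfrac12\left(t^{2H}+s^{2H}-|t-s|^{2H}\right),\qquad s,t\ge 0$$ (for $H=1$ this means $B^1_t=t\xi$ a.s. with $\xi$ standard normal). Let $X^H_t=\int_0^t e^s\,dB^H_s$, the almost sure limit of Riemann sums as the mesh tends to zero, and let $\mathsf V(H,t)=\mathsf E(X^H_t)^2$. For every $H\in[1/2,1]$ and $t>0$ this integral exists almost surely, $X^H_t$ is square integrable, and its law has a density $p_{H,t}$ for which the Shannon entropy $\mathsf S(H,t)=-\int_{\mathbb R}p_{H,t}(x)\log p_{H,t}(x)\,dx$ is finite. There are real numbers $\tau_1,\tau_{1/2}$ with $$1<\tau_1<\log 3<\tau_{1/2},$$ and for every $t\in(\tau_1,\tau_{1/2})$ a number $H_t\in(1/2,1)$, all independent of the choice of the processes $B^H$, such that the following holds. (a) For $t\in(0,\tau_1]$, $\mathsf V(H,t)$ is strictly decreasing in $H\in[1/2,1]$. (b) For $t\in(\tau_1,\log 3)$,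 $\mathsf V(H,t)$ is strictly decreasing in $H\in[1/2,H_t]$ and strictly increasing in $H\in[H_t,1]$, and $\mathsf V(1,t)<\mathsf V(1/2,t)$. (c) For $t=\log 3$, $\mathsf V(H,t)$ is strictly decreasing in $H\in[1/2,H_t]$ and strictly increasing in $H\in[H_t,1]$, and $\mathsf V(1,t)=\mathsf V(1/2,t)$. (d) For $t\in(\log 3,\tau_{1/2})$, $\mathsf V(H,t)$ is strictly decreasing in $H\in[1/2,H_t]$ and strictly increasing in $H\in[H_t,1]$, and $\mathsf V(1,t)>\mathsf V(1/2,t)$. (e) For $t\ge\tau_{1/2}$, $\mathsf V(H,t)$ is strictly increasing in $H\in[1/2,1]$. The statements (a)–(e) also hold, with the same $\tau_1$, $\tau_{1/2}$ and $H_t$, with $\mathsf S$ in place of $\mathsf V$. -/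

import Mathlib

open MeasureTheory ProbabilityTheory Set
open scoped NNReal

noncomputable section

/-- `B` is a fractional Brownian motion with Hurst index `H` (used for `0 < H ≤ 1`) under `P`:
a centered Gaussian process on `[0, ∞)` with covariance
`E (B t * B s) = (t ^ (2H) + s ^ (2H) - |t - s| ^ (2H)) / 2` and almost surely continuous paths.
For `H = 1` the covariance is `t * s`, so that `B t = t * B 1` almost surely. -/
structure IsFractionalBrownianMotion {Ω : Type*} [MeasurableSpace Ω] (H : ℝ)
    (B : ℝ≥0 → Ω → ℝ) (P : Measure Ω) : Prop where
  isGaussianProcess : IsGaussianProcess B P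
  mean_zero : ∀ t, ∫ ω, B t ω ∂P = 0
  covariance : ∀ t s : ℝ≥0, ∫ ω, B t ω * B s ω ∂P =
    (1 / 2) * ((t : ℝ) ^ (2 * H) + (s : ℝ) ^ (2 * H) - |(t : ℝ) - (s : ℝ)| ^ (2 * H))
  continuous_paths : ∀ᵐ ω ∂P, Continuous fun t => B t ω

/-- `I` is the Riemann–Stieltjes integral `∫_a^b f dg` (for `a ≤ b`): the Riemann sums
`∑ f (ξ i) * (g (x (i + 1)) - g (x i))` over the tagged partitions
`a = x 0 ≤ x 1 ≤ ⋯ ≤ x n = b`, `ξ i ∈ [x i, x (i + 1)]`, tend to `I` as the mesh tends to zero. -/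
def HasStieltjesIntegral (f g : ℝ → ℝ) (a b I : ℝ) : Prop :=
  ∀ ε > 0, ∃ δ > 0, ∀ (n : ℕ) (x ξ : ℕ → ℝ), x 0 = a → x n = b →
    (∀ i < n, ξ i ∈ Icc (x i) (x (i + 1)) ∧ x (i + 1) - x i < δ) →
    |∑ i ∈ Finset.range n, f (ξ i) * (g (x (i + 1)) - g (x i)) - I| < ε

open Classical in
/-- The Riemann–Stieltjes integral `∫_a^b f dg` (zero if it does not exist). -/
def stieltjesIntegral (f g : ℝ → ℝ) (a b : ℝ) : ℝ :=
  if h : ∃ I, HasStieltjesIntegral f g a b I then h.choose else 0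

/-- The path `s ↦ B s ω`, as a function on `ℝ` (constant on `(-∞, 0]`). -/
def path {Ω : Type*} (B : ℝ≥0 → Ω → ℝ) (ω : Ω) (s : ℝ) : ℝ := B s.toNNReal ω

/-- The process `X t = ∫_0^t e ^ s dB s`, `t ≥ 0`. -/
def expWienerIntegral {Ω : Type*} (B : ℝ≥0 → Ω → ℝ) (t : ℝ) (ω : Ω) : ℝ :=
  stieltjesIntegral Real.exp (path B ω) 0 t

/-- The second moment `E (X ^ 2)` of a real random variable. -/
def secondMoment {Ω : Type*} [MeasurableSpace Ω] (P : Measure Ω) (X : Ω → ℝ) : ℝ :=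
  ∫ ω, X ω ^ 2 ∂P

/-- The density of the law of a real random variable with respect to Lebesgue measure. -/
def lawDensity {Ω : Type*} [MeasurableSpace Ω] (P : Measure Ω) (X : Ω → ℝ) (x : ℝ) : ℝ :=
  ((P.map X).rnDeriv volume x).toReal

/-- The Shannon (differential) entropy `-∫ p x * log (p x) dx` of a real random variable
with density `p`. -/
def shannonEntropy {Ω : Type*} [MeasurableSpace Ω] (P : Measure Ω) (X : Ω → ℝ) : ℝ :=
  ∫ x, -(lawDensity P X x * Real.log (lawDensity P X x))

end

/-!
For a continuous path `g`, integration by parts gives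
`∫_0^t e ^ s dg s = e ^ t * g t - g 0 - ∫_0^t e ^ s * g s ds` (`hasStieltjesIntegral_exp`), so the
integral of fractional Brownian motion exists almost surely and is an almost sure limit of
Riemann sums. These are centered Gaussian, and their second moments are double Riemann sums of the
covariance, which converge to the iterated Stieltjes integral of the covariance
(`tendsto_expSum_expSum`). Passing to the limit in the characteristic functions, the integral has
the law `N(0, V(H, t))`, where (`expStieltjes_fbm_covariance`)

`V(H, t) = e ^ t * G (2 * H) t`, `G a t = t ^ a + ∫_0^t r ^ a * sinh (t - r) dr`.

The entropy of `N(0, v)` is `log (2πv) / 2 + 1 / 2`, which is strictly increasing in `v`, so only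
the monotonicity of `G` (`varKernel`) in `a ∈ [1, 2]` matters. As `a ↦ r ^ a` is convex, `G` is
strictly convex in `a`; its behaviour is determined by the signs of its slopes at `a = 1` and
`a = 2`, where the slope is
`D a t = t ^ a * log t + ∫_0^t r ^ a * log r * sinh (t - r) dr` (`varSlope`). Convexity is used in
the form `G a t + (b - a) * D a t < G b t` (`varKernel_tangent_lt`), which also makes `D` strictly
increasing in `a`, so `G` is never differentiated.

For `a = 1, 2` the slope is negative for `t ≤ 1`, and `e ^ (-t) * D a t` is strictly increasing for
`t ≥ 1` (`strictMonoOn_exp_neg_mul_add_integral`), so `D a` changes sign at most once; `τ₁` and `τ₂`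
are the zeros of `D 2` and `D 1`. Since `G 1 t = sinh t` and `G 2 t = 2 cosh t - 2`, the values of
`G` at `a = 1` and `a = 2` agree exactly at `t = log 3`, and strict convexity there gives
`D 1 (log 3) < 0 < D 2 (log 3)`, that is, `τ₁ < log 3 < τ₂`. That `D 1` becomes positive follows from
`r * log r ≥ r - 1` (`varSlope_one_lower`). Between `τ₁` and `τ₂`, the minimum `h t` is half the zero
of `a ↦ D a t`.
-/

/-! ### The variance kernel and its tangent inequality -/

/-- The function with `V(H, t) = exp t * varKernel (2 * H) t`, where `V(H, t)` is the variance of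
`∫_0^t e ^ s dB s`. -/
noncomputable def varKernel (a t : ℝ) : ℝ :=
  t ^ a + ∫ r in (0 : ℝ)..t, r ^ a * Real.sinh (t - r)

/-- The slope of `varKernel a t` in the exponent `a`, obtained by differentiating under the
integral. It enters only through the tangent inequality `varKernel_tangent_lt`. -/
noncomputable def varSlope (a t : ℝ) : ℝ :=
  t ^ a * Real.log t + ∫ r in (0 : ℝ)..t, r ^ a * Real.log r * Real.sinh (t - r)

/-- The right-hand side is continuous in `r`, and jointly in `(a, r)` for `a > 0`, since `x * log x` is. -/
theorem rpow_mul_log_eq {a r : ℝ} (ha : 0 < a) (hr : 0 ≤ r) :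
    r ^ a * Real.log r = r ^ a * Real.log (r ^ a) / a := by
  rcases hr.eq_or_lt with rfl | hr
  · simp [Real.zero_rpow ha.ne']
  · rw [Real.log_rpow hr]
    field_simp

theorem continuousOn_rpow_mul_log {a : ℝ} (ha : 0 < a) :
    ContinuousOn (fun r : ℝ => r ^ a * Real.log r) (Ici 0) := by
  have h : Continuous fun r : ℝ => r ^ a * Real.log (r ^ a) / a :=
    (Real.continuous_mul_log.comp (Real.continuous_rpow_const ha.le)).div_const a
  exact h.continuousOn.congr fun r hr => rpow_mul_log_eq ha hr

theorem rpow_tangent_le {a b r : ℝ} (ha : 0 < a) (hb : 0 < b) (hr : 0 ≤ r) :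
    r ^ a + (b - a) * (r ^ a * Real.log r) ≤ r ^ b := by
  rcases hr.eq_or_lt with rfl | hr
  · simp [Real.zero_rpow ha.ne', Real.zero_rpow hb.ne']
  · have h1 : r ^ b = r ^ a * Real.exp ((b - a) * Real.log r) := by
      rw [Real.rpow_def_of_pos hr, Real.rpow_def_of_pos hr, ← Real.exp_add]
      ring_nf
    have h2 := Real.add_one_le_exp ((b - a) * Real.log r)
    have h3 := mul_le_mul_of_nonneg_left h2 (Real.rpow_pos_of_pos hr a).le
    rw [h1]
    linarith

theorem rpow_tangent_lt {a b r : ℝ} (hab : a ≠ b) (hr : 0 < r) (hr1 : r ≠ 1) :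
    r ^ a + (b - a) * (r ^ a * Real.log r) < r ^ b := by
  have h1 : r ^ b = r ^ a * Real.exp ((b - a) * Real.log r) := by
    rw [Real.rpow_def_of_pos hr, Real.rpow_def_of_pos hr, ← Real.exp_add]
    ring_nf
  have h0 : (b - a) * Real.log r ≠ 0 :=
    mul_ne_zero (sub_ne_zero.2 hab.symm) (Real.log_ne_zero_of_pos_of_ne_one hr hr1)
  have h3 := mul_lt_mul_of_pos_left (Real.add_one_lt_exp h0) (Real.rpow_pos_of_pos hr a)
  rw [h1]
  linarith

theorem continuousOn_rpow_mul_sinh {a : ℝ} (ha : 0 < a) (t : ℝ) (s : Set ℝ) :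
    ContinuousOn (fun r : ℝ => r ^ a * Real.sinh (t - r)) s :=
  ((Real.continuous_rpow_const ha.le).mul
    (Real.continuous_sinh.comp (continuous_const.sub continuous_id))).continuousOn

theorem continuousOn_rpow_mul_log_mul_sinh {a : ℝ} (ha : 0 < a) (t : ℝ) :
    ContinuousOn (fun r : ℝ => r ^ a * Real.log r * Real.sinh (t - r)) (Icc 0 t) :=
  ((continuousOn_rpow_mul_log ha).mono fun _ hx => hx.1).mul
    (Real.continuous_sinh.comp (continuous_const.sub continuous_id)).continuousOn

/-- Strict convexity of `varKernel · t`, in tangent form: the graph lies above its tangents. -/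
theorem varKernel_tangent_lt {a b t : ℝ} (ha : 0 < a) (hb : 0 < b) (hab : a ≠ b) (ht : 0 < t) :
    varKernel a t + (b - a) * varSlope a t < varKernel b t := by
  have hc1 := continuousOn_rpow_mul_sinh ha t (Icc 0 t)
  have hc2 := continuousOn_rpow_mul_log_mul_sinh ha t
  have hi1 := hc1.intervalIntegrable_of_Icc (μ := volume) ht.le
  have hi2 := hc2.intervalIntegrable_of_Icc (μ := volume) ht.le
  have hsinh : ∀ r ≤ t, 0 ≤ Real.sinh (t - r) := fun r hr =>
    Real.sinh_nonneg_iff.2 (sub_nonneg.2 hr)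
  have hlt : (∫ r in (0 : ℝ)..t, (r ^ a * Real.sinh (t - r) +
      (b - a) * (r ^ a * Real.log r * Real.sinh (t - r)))) <
      ∫ r in (0 : ℝ)..t, r ^ b * Real.sinh (t - r) := by
    refine intervalIntegral.integral_lt_integral_of_continuousOn_of_le_of_exists_lt ht
      (hc1.add (continuousOn_const.mul hc2)) (continuousOn_rpow_mul_sinh hb t _) ?_
      ⟨min t 1 / 2, ⟨by positivity, ?_⟩, ?_⟩
    · intro r hr
      have := mul_le_mul_of_nonneg_right (rpow_tangent_le ha hb hr.1.le) (hsinh r hr.2)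
      linarith
    · have := min_le_left t 1
      linarith
    · have h1 := min_le_left t 1
      have h2 := min_le_right t 1
      have h3 : 0 < min t 1 := by positivity
      have := mul_lt_mul_of_pos_right (rpow_tangent_lt (r := min t 1 / 2) hab (by positivity)
        (by linarith)) (Real.sinh_pos_iff.2 (show 0 < t - min t 1 / 2 by linarith))
      linarith
  rw [intervalIntegral.integral_add hi1 (hi2.const_mul _),
    intervalIntegral.integral_const_mul] at hlt
  have := rpow_tangent_le ha hb ht.le
  unfold varKernel varSlope
  linarith

theorem varSlope_lt_varSlope {a b t : ℝ} (ha : 0 < a) (hab : a < b) (ht : 0 < t) :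
    varSlope a t < varSlope b t := by
  have h1 := varKernel_tangent_lt ha (ha.trans hab) hab.ne ht
  have h2 := varKernel_tangent_lt (ha.trans hab) ha hab.ne' ht
  have h3 : 0 < (b - a) * (varSlope b t - varSlope a t) := by linarith
  have := (pos_iff_pos_of_mul_pos h3).1 (sub_pos.2 hab)
  linarith

theorem varKernel_strictAntiOn {a c t : ℝ} (ha : 0 < a) (ht : 0 < t) (hc : varSlope c t ≤ 0) :
    StrictAntiOn (fun b => varKernel b t) (Icc a c) := by
  intro x hx y hy hxy
  have hx0 : 0 < x := ha.trans_le hx.1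
  have hy0 : 0 < y := hx0.trans hxy
  have h1 := varKernel_tangent_lt hy0 hx0 hxy.ne' ht
  have h2 : varSlope y t ≤ varSlope c t := by
    rcases hy.2.eq_or_lt with h | h
    · rw [h]
    · exact (varSlope_lt_varSlope hy0 h ht).le
  have := mul_nonneg_of_nonpos_of_nonpos (sub_nonpos.2 hxy.le) (h2.trans hc)
  simp only
  linarith

theorem varKernel_strictMonoOn {c b t : ℝ} (hc0 : 0 < c) (ht : 0 < t) (hc : 0 ≤ varSlope c t) :
    StrictMonoOn (fun a => varKernel a t) (Icc c b) := by
  intro x hx y hy hxy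
  have hx0 : 0 < x := hc0.trans_le hx.1
  have hy0 : 0 < y := hx0.trans hxy
  have h1 := varKernel_tangent_lt hx0 hy0 hxy.ne ht
  have h2 : varSlope c t ≤ varSlope x t := by
    rcases hx.1.eq_or_lt with h | h
    · rw [h]
    · exact (varSlope_lt_varSlope hc0 h ht).le
  have := mul_nonneg (sub_nonneg.2 hxy.le) (hc.trans h2)
  simp only
  linarith

theorem varKernel_pos {a t : ℝ} (ht : 0 < t) : 0 < varKernel a t := by
  refine add_pos_of_pos_of_nonneg (Real.rpow_pos_of_pos ht a) ?_
  refine intervalIntegral.integral_nonneg ht.le fun r hr => ?_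
  exact mul_nonneg (Real.rpow_nonneg hr.1 a) (Real.sinh_nonneg_iff.2 (sub_nonneg.2 hr.2))

theorem continuousOn_varSlope {t : ℝ} (ht : 0 ≤ t) :
    ContinuousOn (fun a => varSlope a t) (Ici 1) := by
  -- clamping the exponent at `1` makes the integrand jointly continuous on the whole plane
  have hpow : Continuous fun p : ℝ × ℝ => p.2 ^ (max p.1 1) := by
    refine Continuous.rpow continuous_snd (continuous_fst.max continuous_const) fun p => ?_
    right
    positivity
  have hφ : Continuous fun p : ℝ × ℝ =>
      p.2 ^ (max p.1 1) * Real.log (p.2 ^ (max p.1 1)) / (max p.1 1) := by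
    refine (Real.continuous_mul_log.comp hpow).div (continuous_fst.max continuous_const)
      fun p => ?_
    positivity
  have hint : Continuous fun a : ℝ => ∫ r in (0 : ℝ)..t,
      r ^ (max a 1) * Real.log (r ^ (max a 1)) / (max a 1) * Real.sinh (t - r) := by
    refine intervalIntegral.continuous_parametric_intervalIntegral_of_continuous' ?_ 0 t
    exact hφ.mul (Real.continuous_sinh.comp (continuous_const.sub continuous_snd))
  have htop : Continuous fun a : ℝ =>
      t ^ (max a 1) * Real.log (t ^ (max a 1)) / (max a 1) :=
    hφ.comp (continuous_id.prodMk continuous_const)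
  refine (htop.add hint).continuousOn.congr fun a ha => ?_
  have ha0 : (0 : ℝ) < a := zero_lt_one.trans_le ha
  have hm : max a 1 = a := max_eq_left ha
  simp only [varSlope, Pi.add_apply, hm]
  rw [rpow_mul_log_eq ha0 ht]
  congr 1
  refine intervalIntegral.integral_congr fun r hr => ?_
  rw [uIcc_of_le ht] at hr
  simp only [rpow_mul_log_eq ha0 hr.1]

theorem exists_varSlope_eq_zero {t : ℝ} (ht : 0 < t) (h1 : varSlope 1 t < 0)
    (h2 : 0 < varSlope 2 t) : ∃ c ∈ Ioo (1 : ℝ) 2, varSlope c t = 0 := by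
  have hc : ContinuousOn (fun a => varSlope a t) (Icc 1 2) :=
    (continuousOn_varSlope ht.le).mono fun _ hx => hx.1
  obtain ⟨c, hc, h0⟩ := intermediate_value_Ioo (by norm_num) hc ⟨h1, h2⟩
  exact ⟨c, hc, h0⟩

/-! ### The exponents one and two -/

theorem varKernel_one (t : ℝ) : varKernel 1 t = Real.sinh t := by
  have h : ∀ r ∈ uIcc (0 : ℝ) t, HasDerivAt
      (fun r => -(r * Real.cosh (t - r)) - Real.sinh (t - r)) (r * Real.sinh (t - r)) r := by
    intro r _
    have hd : HasDerivAt (fun r : ℝ => t - r) (-1) r := by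
      simpa using (hasDerivAt_id r).const_sub t
    exact ((((hasDerivAt_id r).mul hd.cosh).neg).sub hd.sinh).congr_deriv (by simp)
  have hc : Continuous fun r : ℝ => r * Real.sinh (t - r) := by fun_prop
  have := intervalIntegral.integral_eq_sub_of_hasDerivAt h (hc.intervalIntegrable _ _)
  simp only [varKernel, Real.rpow_one, this]
  simp

theorem varKernel_two (t : ℝ) : varKernel 2 t = 2 * Real.cosh t - 2 := by
  have h : ∀ r ∈ uIcc (0 : ℝ) t, HasDerivAt
      (fun r => -(r ^ 2 * Real.cosh (t - r)) - 2 * (r * Real.sinh (t - r)) -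
        2 * Real.cosh (t - r)) (r ^ 2 * Real.sinh (t - r)) r := by
    intro r _
    have hd : HasDerivAt (fun r : ℝ => t - r) (-1) r := by
      simpa using (hasDerivAt_id r).const_sub t
    exact (((((hasDerivAt_pow 2 r).mul hd.cosh).neg).sub
      (((hasDerivAt_id r).mul hd.sinh).const_mul 2)).sub (hd.cosh.const_mul 2)).congr_deriv
      (by simp; ring)
  have hc : Continuous fun r : ℝ => r ^ 2 * Real.sinh (t - r) := by fun_prop
  have := intervalIntegral.integral_eq_sub_of_hasDerivAt h (hc.intervalIntegrable _ _)
  simp only [varKernel, Real.rpow_two, this]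
  simp
  ring

/-- In terms of the variance: `V(1, t) - V(1/2, t) = (e ^ t - 1) * (e ^ t - 3) / 2`. -/
theorem varKernel_two_sub_one (t : ℝ) :
    varKernel 2 t - varKernel 1 t = (Real.exp t - 1) * (Real.exp t - 3) / (2 * Real.exp t) := by
  rw [varKernel_one, varKernel_two, Real.cosh_eq, Real.sinh_eq, Real.exp_neg]
  field_simp
  ring

theorem varSlope_neg {a t : ℝ} (ha : 0 < a) (ht : 0 < t) (ht1 : t ≤ 1) : varSlope a t < 0 := by
  have h1 : t ^ a * Real.log t ≤ 0 :=
    mul_nonpos_of_nonneg_of_nonpos (Real.rpow_nonneg ht.le a) (Real.log_nonpos ht.le ht1)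
  have h2 : 0 < ∫ r in (0 : ℝ)..t, -(r ^ a * Real.log r * Real.sinh (t - r)) := by
    refine intervalIntegral.intervalIntegral_pos_of_pos_on
      ((continuousOn_rpow_mul_log_mul_sinh ha t).neg.intervalIntegrable_of_Icc ht.le) ?_ ht
    intro r hr
    have hs : 0 < Real.sinh (t - r) := Real.sinh_pos_iff.2 (sub_pos.2 hr.2)
    have hl : 0 < -Real.log r := neg_pos.2 (Real.log_neg hr.1 (hr.2.trans_le ht1))
    have := mul_pos (mul_pos (Real.rpow_pos_of_pos hr.1 a) hl) hs
    linarith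
  rw [intervalIntegral.integral_neg] at h2
  unfold varSlope
  linarith

theorem sub_one_le_mul_log {r : ℝ} (hr : 0 ≤ r) : r - 1 ≤ r * Real.log r := by
  rcases hr.eq_or_lt with rfl | hr
  · simp
  · have := mul_le_mul_of_nonneg_left (Real.one_sub_inv_le_log_of_pos hr) hr.le
    rwa [mul_sub, mul_inv_cancel₀ hr.ne', mul_one] at this

theorem varSlope_one_lower {t : ℝ} (ht : 0 ≤ t) :
    t * Real.log t - t + 1 - Real.exp (-t) ≤ varSlope 1 t := by
  have h : ∀ r ∈ uIcc (0 : ℝ) t, HasDerivAt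
      (fun r => -((r - 1) * Real.cosh (t - r)) - Real.sinh (t - r))
      ((r - 1) * Real.sinh (t - r)) r := by
    intro r _
    have hd : HasDerivAt (fun r : ℝ => t - r) (-1) r := by
      simpa using (hasDerivAt_id r).const_sub t
    exact (((((hasDerivAt_id r).sub_const 1).mul hd.cosh).neg).sub hd.sinh).congr_deriv
      (by simp)
  have hc : Continuous fun r : ℝ => (r - 1) * Real.sinh (t - r) := by fun_prop
  have h1 := intervalIntegral.integral_eq_sub_of_hasDerivAt h (hc.intervalIntegrable _ _)
  have h2 : (∫ r in (0 : ℝ)..t, (r - 1) * Real.sinh (t - r)) ≤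
      ∫ r in (0 : ℝ)..t, r ^ (1 : ℝ) * Real.log r * Real.sinh (t - r) := by
    refine intervalIntegral.integral_mono_on ht (hc.intervalIntegrable _ _)
      ((continuousOn_rpow_mul_log_mul_sinh one_pos t).intervalIntegrable_of_Icc ht) ?_
    intro r hr
    rw [Real.rpow_one]
    exact mul_le_mul_of_nonneg_right (sub_one_le_mul_log hr.1)
      (Real.sinh_nonneg_iff.2 (sub_nonneg.2 hr.2))
  rw [h1] at h2
  have h3 := Real.cosh_sub_sinh t
  simp only [sub_self, Real.cosh_zero, Real.sinh_zero, sub_zero] at h2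
  unfold varSlope
  rw [Real.rpow_one t]
  linarith

theorem varSlope_one_exp_one_pos : 0 < varSlope 1 (Real.exp 1) := by
  have h := varSlope_one_lower (Real.exp_pos 1).le
  rw [Real.log_exp] at h
  have : Real.exp (-Real.exp 1) < 1 := Real.exp_lt_one_iff.2 (by simp [Real.exp_pos])
  linarith

/-! ### Monotonicity in time -/

theorem integral_mul_sinh_eq {f : ℝ → ℝ} (hf : Continuous f) (t : ℝ) :
    (∫ r in (0 : ℝ)..t, f r * Real.sinh (t - r)) =
      (Real.exp t * (∫ r in (0 : ℝ)..t, f r * Real.exp (-r)) -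
        Real.exp (-t) * ∫ r in (0 : ℝ)..t, f r * Real.exp r) / 2 := by
  have h3 : Continuous fun r : ℝ => Real.exp t * (f r * Real.exp (-r)) := by fun_prop
  have h4 : Continuous fun r : ℝ => Real.exp (-t) * (f r * Real.exp r) := by fun_prop
  rw [← intervalIntegral.integral_const_mul, ← intervalIntegral.integral_const_mul,
    ← intervalIntegral.integral_sub (h3.intervalIntegrable _ _) (h4.intervalIntegrable _ _),
    ← intervalIntegral.integral_div]
  refine intervalIntegral.integral_congr fun r _ => ?_
  simp only [Real.sinh_eq]
  rw [show t - r = t + -r by ring, show -(t + -r) = -t + r by ring, Real.exp_add, Real.exp_add]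
  ring

/-- If `f` vanishes with slope one at `1`, is convex afterwards and at least `-1` before, then
`exp (-t) * (f t + ∫_0^t f r * sinh (t - r) dr)` is strictly increasing for `t ≥ 1`: its derivative
is `exp (-2t)` times `exp t * (f' t - f t) + ∫_0^t f r * exp r dr`, which is positive at `1`
and has derivative `exp t * f'' t`. -/
theorem strictMonoOn_exp_neg_mul_add_integral {f f' f'' : ℝ → ℝ} (hf : Continuous f)
    (hf' : ∀ x, 0 < x → HasDerivAt f (f' x) x) (hf'' : ∀ x, 0 < x → HasDerivAt f' (f'' x) x)
    (hpos : ∀ x, 1 < x → 0 < f'' x) (h0 : f 1 = 0) (h1 : f' 1 = 1)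
    (hlow : ∀ x ∈ Icc (0 : ℝ) 1, -1 ≤ f x) :
    StrictMonoOn (fun t => Real.exp (-t) *
      (f t + ∫ r in (0 : ℝ)..t, f r * Real.sinh (t - r))) (Ici 1) := by
  have c1 : Continuous fun r : ℝ => f r * Real.exp (-r) := by fun_prop
  have c2 : Continuous fun r : ℝ => f r * Real.exp r := by fun_prop
  set A : ℝ → ℝ := fun t => ∫ r in (0 : ℝ)..t, f r * Real.exp (-r) with hA
  set B : ℝ → ℝ := fun t => ∫ r in (0 : ℝ)..t, f r * Real.exp r with hB
  have dA : ∀ t, HasDerivAt A (f t * Real.exp (-t)) t := fun t =>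
    intervalIntegral.integral_hasDerivAt_right (c1.intervalIntegrable _ _)
      c1.aestronglyMeasurable.stronglyMeasurableAtFilter c1.continuousAt
  have dB : ∀ t, HasDerivAt B (f t * Real.exp t) t := fun t =>
    intervalIntegral.integral_hasDerivAt_right (c2.intervalIntegrable _ _)
      c2.aestronglyMeasurable.stronglyMeasurableAtFilter c2.continuousAt
  have dneg : ∀ t : ℝ, HasDerivAt (fun t => Real.exp (-t)) (-Real.exp (-t)) t := fun t => by
    simpa using (hasDerivAt_neg t).exp
  set K : ℝ → ℝ := fun t => Real.exp t * (f' t - f t) + B t with hK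
  have dK : ∀ t, 0 < t → HasDerivAt K (Real.exp t * f'' t) t := fun t ht => by
    exact (((Real.hasDerivAt_exp t).mul ((hf'' t ht).sub (hf' t ht))).add (dB t)).congr_deriv
      (by simp; ring)
  have K1 : 0 < K 1 := by
    have : (∫ r in (0 : ℝ)..1, -Real.exp r) ≤ B 1 := by
      refine intervalIntegral.integral_mono_on zero_le_one
        (Real.continuous_exp.neg.intervalIntegrable _ _) (c2.intervalIntegrable _ _) ?_
      intro r hr
      have := mul_le_mul_of_nonneg_right (hlow r hr) (Real.exp_pos r).le
      linarith
    rw [intervalIntegral.integral_neg, integral_exp, Real.exp_zero] at this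
    simp only [hK, h0, h1]
    linarith
  have Kpos : ∀ t, 1 ≤ t → 0 < K t := by
    have : MonotoneOn K (Ici 1) := by
      refine monotoneOn_of_deriv_nonneg (convex_Ici 1)
        (fun t ht => (dK t (zero_lt_one.trans_le ht)).continuousAt.continuousWithinAt) ?_ ?_
      · intro t ht
        rw [interior_Ici] at ht
        exact (dK t (zero_lt_one.trans ht)).differentiableAt.differentiableWithinAt
      · intro t ht
        rw [interior_Ici] at ht
        rw [(dK t (zero_lt_one.trans ht)).deriv]
        exact (mul_pos (Real.exp_pos t) (hpos t ht)).le
    exact fun t ht => K1.trans_le (this self_mem_Ici ht ht)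
  have dL : ∀ t, 0 < t → HasDerivAt
      (fun t => Real.exp (-t) * (f t + (Real.exp t * A t - Real.exp (-t) * B t) / 2))
      (Real.exp (-t) * (Real.exp (-t) * K t)) t := fun t ht => by
    refine ((dneg t).mul ((hf' t ht).add
      ((((Real.hasDerivAt_exp t).mul (dA t)).sub
        ((dneg t).mul (dB t))).div_const 2))).congr_deriv ?_
    simp only [hK, Pi.add_apply, Pi.sub_apply, Pi.mul_apply]
    have : Real.exp (-t) * Real.exp t = 1 := by rw [← Real.exp_add]; simp
    linear_combination (-(Real.exp (-t) * (f' t - f t))) * this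
  simp_rw [integral_mul_sinh_eq hf]
  refine strictMonoOn_of_deriv_pos (convex_Ici 1)
    (fun t ht => (dL t (zero_lt_one.trans_le ht)).continuousAt.continuousWithinAt) ?_
  intro t ht
  rw [interior_Ici] at ht
  rw [(dL t (zero_lt_one.trans ht)).deriv]
  have := Kpos t ht.le
  positivity

theorem strictMonoOn_exp_neg_mul_varSlope_one :
    StrictMonoOn (fun t => Real.exp (-t) * varSlope 1 t) (Ici 1) := by
  have h := strictMonoOn_exp_neg_mul_add_integral (f := fun x => x * Real.log x)
    (f' := fun x => Real.log x + 1) (f'' := fun x => x⁻¹) Real.continuous_mul_log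
    (fun x hx => Real.hasDerivAt_mul_log hx.ne')
    (fun x hx => (Real.hasDerivAt_log hx.ne').add_const 1)
    (fun x hx => inv_pos.2 (zero_lt_one.trans hx)) (by simp) (by simp)
    (fun x hx => by linarith [sub_one_le_mul_log hx.1, hx.1])
  simpa only [varSlope, Real.rpow_one] using h

theorem strictMonoOn_exp_neg_mul_varSlope_two :
    StrictMonoOn (fun t => Real.exp (-t) * varSlope 2 t) (Ici 1) := by
  have h := strictMonoOn_exp_neg_mul_add_integral (f := fun x => x * (x * Real.log x))
    (f' := fun x => 2 * (x * Real.log x) + x) (f'' := fun x => 2 * (Real.log x + 1) + 1)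
    (continuous_id.mul Real.continuous_mul_log)
    (fun x hx => by
      exact ((hasDerivAt_id x).mul (Real.hasDerivAt_mul_log hx.ne')).congr_deriv
        (by simp; ring))
    (fun x hx => ((Real.hasDerivAt_mul_log hx.ne').const_mul 2).add (hasDerivAt_id x))
    (fun x hx => by linarith [Real.log_pos hx]) (by simp) (by simp)
    (fun x hx => by
      nlinarith [mul_le_mul_of_nonneg_left (sub_one_le_mul_log hx.1) hx.1, hx.1, hx.2])
  simpa only [varSlope, Real.rpow_two, pow_two, mul_assoc] using h

theorem continuousOn_varSlope_time {a : ℝ} (ha : 0 < a) :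
    ContinuousOn (fun t => varSlope a t) (Ici 0) := by
  have hφ : Continuous fun r : ℝ => r ^ a * Real.log (r ^ a) / a :=
    (Real.continuous_mul_log.comp (Real.continuous_rpow_const ha.le)).div_const a
  have hint : Continuous fun t : ℝ => ∫ r in (0 : ℝ)..t,
      r ^ a * Real.log (r ^ a) / a * Real.sinh (t - r) := by
    refine intervalIntegral.continuous_parametric_intervalIntegral_of_continuous
      (f := fun t r : ℝ => r ^ a * Real.log (r ^ a) / a * Real.sinh (t - r)) ?_ continuous_id
    exact (hφ.comp continuous_snd).mul
      (Real.continuous_sinh.comp (continuous_fst.sub continuous_snd))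
  refine (hφ.add hint).continuousOn.congr fun t ht => ?_
  simp only [varSlope]
  rw [rpow_mul_log_eq ha ht]
  congr 1
  refine intervalIntegral.integral_congr fun r hr => ?_
  rw [uIcc_of_le ht] at hr
  simp only [rpow_mul_log_eq ha hr.1]

/-- A slope that increases after division by `exp t` on `[1, ∞)` and is positive somewhere
there changes sign exactly once. -/
theorem exists_sign_change {a u v : ℝ} (ha : 0 < a)
    (hmono : StrictMonoOn (fun t => Real.exp (-t) * varSlope a t) (Ici 1))
    (hu1 : 1 ≤ u) (huv : u ≤ v) (hu : varSlope a u < 0) (hv : 0 < varSlope a v) :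
    ∃ τ ∈ Ioo u v, (∀ t, 0 < t → t < τ → varSlope a t < 0) ∧ varSlope a τ = 0 ∧
      ∀ t, τ < t → 0 < varSlope a t := by
  have hc : ContinuousOn (fun t => varSlope a t) (Icc u v) :=
    (continuousOn_varSlope_time ha).mono fun x hx => (zero_le_one.trans hu1).trans hx.1
  obtain ⟨τ, hτ, h0⟩ := intermediate_value_Ioo huv hc ⟨hu, hv⟩
  have hτ1 : (1 : ℝ) < τ := hu1.trans_lt hτ.1
  refine ⟨τ, hτ, fun t ht htτ => ?_, h0, fun t htτ => ?_⟩
  · rcases le_total t 1 with h | h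
    · exact varSlope_neg ha ht h
    · have := hmono h hτ1.le htτ
      simp only [show varSlope a τ = 0 from h0, mul_zero] at this
      exact (pos_iff_neg_of_mul_neg this).1 (Real.exp_pos _)
  · have := hmono hτ1.le (hτ1.trans htτ).le htτ
    simp only [show varSlope a τ = 0 from h0, mul_zero] at this
    exact (pos_iff_pos_of_mul_pos this).1 (Real.exp_pos _)

theorem one_lt_log_three : (1 : ℝ) < Real.log 3 := by
  rw [Real.lt_log_iff_exp_lt (by norm_num)]
  linarith [Real.exp_one_lt_d9]

/-- At `t = log 3` the end values of the strictly convex function `varKernel · t` agree, so its end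
slopes have opposite signs. -/
theorem varSlope_log_three : varSlope 1 (Real.log 3) < 0 ∧ 0 < varSlope 2 (Real.log 3) := by
  have ht : 0 < Real.log 3 := zero_lt_one.trans one_lt_log_three
  have h := varKernel_two_sub_one (Real.log 3)
  rw [Real.exp_log (by norm_num), sub_self, mul_zero, zero_div] at h
  have h1 := varKernel_tangent_lt one_pos two_pos (by norm_num) ht
  have h2 := varKernel_tangent_lt two_pos one_pos (by norm_num) ht
  constructor <;> linarith

theorem exists_sign_change_varSlope_two : ∃ τ ∈ Ioo 1 (Real.log 3),
    (∀ t, 0 < t → t < τ → varSlope 2 t < 0) ∧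
    varSlope 2 τ = 0 ∧ ∀ t, τ < t → 0 < varSlope 2 t :=
  exists_sign_change two_pos strictMonoOn_exp_neg_mul_varSlope_two le_rfl one_lt_log_three.le
    (varSlope_neg two_pos one_pos le_rfl) varSlope_log_three.2

theorem exists_sign_change_varSlope_one : ∃ τ, Real.log 3 < τ ∧
    (∀ t, 0 < t → t < τ → varSlope 1 t < 0) ∧
    varSlope 1 τ = 0 ∧ ∀ t, τ < t → 0 < varSlope 1 t := by
  have h3 : Real.log 3 ≤ Real.exp 1 := by
    have := Real.log_le_sub_one_of_pos (show (0 : ℝ) < 3 by norm_num)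
    linarith [Real.exp_one_gt_d9]
  obtain ⟨τ, hτ, h⟩ := exists_sign_change one_pos strictMonoOn_exp_neg_mul_varSlope_one
    one_lt_log_three.le h3 varSlope_log_three.1 varSlope_one_exp_one_pos
  exact ⟨τ, hτ.1, h⟩

/-! ### Riemann–Stieltjes integrals against the exponential -/

/-- The value `e ^ t * g t - g 0 - ∫_0^t e ^ s g s ds` that integration by parts assigns to
`∫_0^t e ^ s dg s`. -/
noncomputable def expStieltjes (g : ℝ → ℝ) (t : ℝ) : ℝ :=
  Real.exp t * g t - g 0 - ∫ s in (0 : ℝ)..t, Real.exp s * g s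

/-- One term of a Riemann–Stieltjes sum differs from the increment of the integral by at most the
oscillation `ε` of `g` times the increment of `exp`. -/
theorem abs_exp_mul_sub_le {g : ℝ → ℝ} (hg : Continuous g) {a b ξ ε : ℝ} (hξ : ξ ∈ Icc a b)
    (ha : ∀ s ∈ Icc a b, |g s - g a| ≤ ε) (hb : ∀ s ∈ Icc a b, |g s - g b| ≤ ε) :
    |Real.exp ξ * (g b - g a) -
      (Real.exp b * g b - Real.exp a * g a - ∫ s in a..b, Real.exp s * g s)| ≤
      ε * (Real.exp b - Real.exp a) := by
  have hc : ∀ c : ℝ, Continuous fun s => Real.exp s * (g s - c) := fun c => by fun_prop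
  have hcg : Continuous fun s => Real.exp s * g s := by fun_prop
  have hbd : ∀ c u v : ℝ, u ≤ v → (∀ s ∈ Icc u v, |g s - c| ≤ ε) →
      |∫ s in u..v, Real.exp s * (g s - c)| ≤ ε * (Real.exp v - Real.exp u) := by
    intro c u v huv h
    rw [← integral_exp, ← intervalIntegral.integral_const_mul]
    refine (intervalIntegral.abs_integral_le_integral_abs huv).trans ?_
    refine intervalIntegral.integral_mono_on huv ((hc c).abs.intervalIntegrable _ _)
      ((continuous_const.mul Real.continuous_exp).intervalIntegrable _ _) fun s hs => ?_
    rw [abs_mul, abs_of_pos (Real.exp_pos s), mul_comm]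
    exact mul_le_mul_of_nonneg_right (h s hs) (Real.exp_pos s).le
  have hint : ∀ c u v : ℝ, (∫ s in u..v, Real.exp s * (g s - c)) =
      (∫ s in u..v, Real.exp s * g s) - c * (Real.exp v - Real.exp u) := by
    intro c u v
    have hce : Continuous fun s => c * Real.exp s := by fun_prop
    rw [← integral_exp, ← intervalIntegral.integral_const_mul,
      ← intervalIntegral.integral_sub (hcg.intervalIntegrable _ _) (hce.intervalIntegrable _ _)]
    refine intervalIntegral.integral_congr fun s _ => ?_
    ring
  have h1 := hbd (g a) a ξ hξ.1 fun s hs => ha s ⟨hs.1, hs.2.trans hξ.2⟩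
  have h2 := hbd (g b) ξ b hξ.2 fun s hs => hb s ⟨hξ.1.trans hs.1, hs.2⟩
  have hsplit := intervalIntegral.integral_add_adjacent_intervals
    (hcg.intervalIntegrable (μ := volume) a ξ) (hcg.intervalIntegrable ξ b)
  have hid : Real.exp ξ * (g b - g a) -
      (Real.exp b * g b - Real.exp a * g a - ∫ s in a..b, Real.exp s * g s) =
      (∫ s in a..ξ, Real.exp s * (g s - g a)) + ∫ s in ξ..b, Real.exp s * (g s - g b) := by
    rw [hint, hint, ← hsplit]
    ring
  rw [hid]
  refine (abs_add_le _ _).trans ((add_le_add h1 h2).trans (le_of_eq ?_))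
  ring

theorem partition_mem_Icc {n : ℕ} {x : ℕ → ℝ} (h : ∀ i < n, x i ≤ x (i + 1)) {i : ℕ}
    (hi : i ≤ n) : x 0 ≤ x i ∧ x i ≤ x n := by
  constructor
  · induction i with
    | zero => exact le_rfl
    | succ k ih => exact (ih (by omega)).trans (h k (by omega))
  · induction hi using Nat.decreasingInduction with
    | self => exact le_rfl
    | of_succ k hk ih => exact (h k hk).trans ih

theorem abs_sum_exp_mul_sub_expStieltjes_le {g : ℝ → ℝ} (hg : Continuous g) {t δ ε : ℝ}
    (hmod : ∀ s ∈ Icc 0 t, ∀ u ∈ Icc 0 t, |s - u| < δ → |g s - g u| ≤ ε)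
    {n : ℕ} {x ξ : ℕ → ℝ} (hx0 : x 0 = 0) (hxn : x n = t)
    (hx : ∀ i < n, ξ i ∈ Icc (x i) (x (i + 1)) ∧ x (i + 1) - x i < δ) :
    |∑ i ∈ Finset.range n, Real.exp (ξ i) * (g (x (i + 1)) - g (x i)) - expStieltjes g t| ≤
      ε * (Real.exp t - 1) := by
  have hstep : ∀ i < n, x i ≤ x (i + 1) := fun i hi => (hx i hi).1.1.trans (hx i hi).1.2
  have hcg : Continuous fun s => Real.exp s * g s := by fun_prop
  have htel : expStieltjes g t = ∑ i ∈ Finset.range n,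
      (Real.exp (x (i + 1)) * g (x (i + 1)) - Real.exp (x i) * g (x i) -
        ∫ s in x i..x (i + 1), Real.exp s * g s) := by
    rw [Finset.sum_sub_distrib, Finset.sum_range_sub (fun i => Real.exp (x i) * g (x i)),
      intervalIntegral.sum_integral_adjacent_intervals fun k _ => hcg.intervalIntegrable _ _,
      hx0, hxn, Real.exp_zero, one_mul]
    rfl
  rw [htel, ← Finset.sum_sub_distrib]
  refine (Finset.abs_sum_le_sum_abs _ _).trans ?_
  have hle : ∀ i ∈ Finset.range n, |Real.exp (ξ i) * (g (x (i + 1)) - g (x i)) -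
      (Real.exp (x (i + 1)) * g (x (i + 1)) - Real.exp (x i) * g (x i) -
        ∫ s in x i..x (i + 1), Real.exp s * g s)| ≤
      ε * (Real.exp (x (i + 1)) - Real.exp (x i)) := by
    intro i hi
    have hi := Finset.mem_range.1 hi
    have h1 := partition_mem_Icc hstep hi.le
    have h2 := partition_mem_Icc hstep (Nat.succ_le_of_lt hi)
    rw [hx0, hxn] at h1 h2
    have hδ := (hx i hi).2
    refine abs_exp_mul_sub_le hg (hx i hi).1 (fun s hs => ?_) fun s hs => ?_
    · exact hmod s ⟨h1.1.trans hs.1, hs.2.trans h2.2⟩ _ h1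
        (abs_lt.2 ⟨by linarith [hs.1, hs.2], by linarith [hs.1, hs.2]⟩)
    · exact hmod s ⟨h1.1.trans hs.1, hs.2.trans h2.2⟩ _ h2
        (abs_lt.2 ⟨by linarith [hs.1, hs.2], by linarith [hs.1, hs.2]⟩)
  refine (Finset.sum_le_sum hle).trans (le_of_eq ?_)
  rw [← Finset.mul_sum, Finset.sum_range_sub (fun i => Real.exp (x i)), hx0, hxn, Real.exp_zero]

theorem hasStieltjesIntegral_exp {g : ℝ → ℝ} (hg : Continuous g) (t : ℝ) :
    HasStieltjesIntegral Real.exp g 0 t (expStieltjes g t) := by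
  intro ε hε
  have hE : 0 < Real.exp t := Real.exp_pos t
  have huc : UniformContinuousOn g (Icc 0 t) :=
    isCompact_Icc.uniformContinuousOn_of_continuous hg.continuousOn
  obtain ⟨δ, hδ, h⟩ := Metric.uniformContinuousOn_iff.1 huc (ε / Real.exp t) (by positivity)
  refine ⟨δ, hδ, fun n x ξ h0 hn hx => ?_⟩
  refine (abs_sum_exp_mul_sub_expStieltjes_le hg (δ := δ) (ε := ε / Real.exp t)
    (fun s hs u hu hsu => (h s hs u hu hsu).le) h0 hn hx).trans_lt ?_
  rw [div_mul_eq_mul_div, div_lt_iff₀ hE]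
  nlinarith

/-- Riemann–Stieltjes sums are bounded by the supremum of the integrator, which need not be
continuous. -/
theorem abs_sum_exp_mul_sub_le {g : ℝ → ℝ} {t C : ℝ} (ht : 0 ≤ t) (hC : ∀ s ∈ Icc 0 t, |g s| ≤ C)
    {n : ℕ} {x ξ : ℕ → ℝ} (hx0 : x 0 = 0) (hxn : x n = t)
    (hx : ∀ i < n, ξ i ∈ Icc (x i) (x (i + 1))) :
    |∑ i ∈ Finset.range n, Real.exp (ξ i) * (g (x (i + 1)) - g (x i))| ≤
      2 * Real.exp t * C := by
  have hstep : ∀ i < n, x i ≤ x (i + 1) := fun i hi => (hx i hi).1.trans (hx i hi).2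
  have hg : ∀ i ≤ n, |g (x i)| ≤ C := fun i hi => by
    have := partition_mem_Icc hstep hi
    rw [hx0, hxn] at this
    exact hC _ this
  -- summation by parts
  have hid : ∑ i ∈ Finset.range n, Real.exp (ξ i) * (g (x (i + 1)) - g (x i)) =
      (Real.exp t * g t - g 0) - ∑ i ∈ Finset.range n,
        (g (x (i + 1)) * (Real.exp (x (i + 1)) - Real.exp (ξ i)) +
          g (x i) * (Real.exp (ξ i) - Real.exp (x i))) := by
    have := Finset.sum_range_sub (fun i => Real.exp (x i) * g (x i)) n
    rw [hx0, hxn, Real.exp_zero, one_mul] at this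
    rw [← this, ← Finset.sum_sub_distrib]
    refine Finset.sum_congr rfl fun i _ => ?_
    ring
  have hsum : |∑ i ∈ Finset.range n,
        (g (x (i + 1)) * (Real.exp (x (i + 1)) - Real.exp (ξ i)) +
          g (x i) * (Real.exp (ξ i) - Real.exp (x i)))| ≤ C * (Real.exp t - 1) := by
    have htel := Finset.sum_range_sub (fun i => Real.exp (x i)) n
    rw [hx0, hxn, Real.exp_zero] at htel
    rw [← htel, Finset.mul_sum]
    refine (Finset.abs_sum_le_sum_abs _ _).trans (Finset.sum_le_sum fun i hi => ?_)
    have hi := Finset.mem_range.1 hi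
    have e1 : 0 ≤ Real.exp (x (i + 1)) - Real.exp (ξ i) :=
      sub_nonneg.2 (Real.exp_le_exp.2 (hx i hi).2)
    have e2 : 0 ≤ Real.exp (ξ i) - Real.exp (x i) :=
      sub_nonneg.2 (Real.exp_le_exp.2 (hx i hi).1)
    refine (abs_add_le _ _).trans ?_
    rw [abs_mul, abs_mul, abs_of_nonneg e1, abs_of_nonneg e2]
    have m1 := mul_le_mul_of_nonneg_right (hg (i + 1) hi) e1
    have m2 := mul_le_mul_of_nonneg_right (hg i hi.le) e2
    linarith
  have hbd : |Real.exp t * g t - g 0| ≤ Real.exp t * C + C := by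
    refine (abs_sub _ _).trans ?_
    rw [abs_mul, abs_of_pos (Real.exp_pos t)]
    exact add_le_add (mul_le_mul_of_nonneg_left (hC t ⟨ht, le_rfl⟩) (Real.exp_pos t).le)
      (hC 0 ⟨le_rfl, ht⟩)
  rw [hid]
  refine (abs_sub _ _).trans ?_
  linarith

/-! ### Uniform partitions -/

/-- The Riemann–Stieltjes sum of `∫_0^t e ^ s dg s` over the partition of `[0, t]` into `n + 1`
equal intervals, tagged by their left end points. -/
noncomputable def expSum (n : ℕ) (t : ℝ) (g : ℝ → ℝ) : ℝ :=
  ∑ i ∈ Finset.range (n + 1), Real.exp (i * (t / (n + 1))) *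
    (g ((i + 1 : ℕ) * (t / (n + 1))) - g (i * (t / (n + 1))))

theorem uniform_partition_mem {t : ℝ} (ht : 0 ≤ t) (n i : ℕ) :
    (i : ℝ) * (t / (n + 1)) ∈ Icc ((i : ℝ) * (t / (n + 1))) ((i + 1 : ℕ) * (t / (n + 1))) := by
  refine ⟨le_rfl, mul_le_mul_of_nonneg_right ?_ (by positivity)⟩
  push_cast
  linarith

theorem uniform_partition_last (t : ℝ) (n : ℕ) : ((n + 1 : ℕ) : ℝ) * (t / (n + 1)) = t := by
  push_cast
  field_simp

theorem uniform_partition_mesh (t : ℝ) (n i : ℕ) :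
    ((i + 1 : ℕ) : ℝ) * (t / (n + 1)) - i * (t / (n + 1)) = t / (n + 1) := by
  push_cast
  ring

theorem eventually_mesh_lt (t : ℝ) {δ : ℝ} (hδ : 0 < δ) :
    ∀ᶠ n : ℕ in Filter.atTop, t / ((n : ℝ) + 1) < δ := by
  have h : Filter.Tendsto (fun n : ℕ => t / ((n : ℝ) + 1)) Filter.atTop (nhds 0) := by
    simpa [div_eq_mul_inv] using tendsto_one_div_add_atTop_nhds_zero_nat.const_mul t
  exact h.eventually (gt_mem_nhds hδ)

theorem HasStieltjesIntegral.tendsto_expSum {g : ℝ → ℝ} {t I : ℝ} (ht : 0 ≤ t)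
    (h : HasStieltjesIntegral Real.exp g 0 t I) :
    Filter.Tendsto (fun n => expSum n t g) Filter.atTop (nhds I) := by
  rw [Metric.tendsto_nhds]
  intro ε hε
  obtain ⟨δ, hδ, h⟩ := h ε hε
  filter_upwards [eventually_mesh_lt t hδ] with n hn
  rw [Real.dist_eq]
  exact h (n + 1) (fun i => i * (t / (n + 1))) (fun i => i * (t / (n + 1))) (by simp)
    (uniform_partition_last t n) fun i _ =>
      ⟨uniform_partition_mem ht n i, (uniform_partition_mesh t n i).trans_lt hn⟩

theorem tendsto_expSum {g : ℝ → ℝ} (hg : Continuous g) {t : ℝ} (ht : 0 ≤ t) :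
    Filter.Tendsto (fun n => expSum n t g) Filter.atTop (nhds (expStieltjes g t)) :=
  (hasStieltjesIntegral_exp hg t).tendsto_expSum ht

theorem hasStieltjesIntegral_stieltjesIntegral {g : ℝ → ℝ} (hg : Continuous g) (t : ℝ) :
    HasStieltjesIntegral Real.exp g 0 t (stieltjesIntegral Real.exp g 0 t) := by
  have h : ∃ I, HasStieltjesIntegral Real.exp g 0 t I := ⟨_, hasStieltjesIntegral_exp hg t⟩
  unfold stieltjesIntegral
  rw [dif_pos h]
  exact h.choose_spec

/-! ### Double sums of a covariance -/

theorem continuous_expStieltjes {R : ℝ → ℝ → ℝ} (hR : Continuous (Function.uncurry R)) (t : ℝ) :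
    Continuous fun s => expStieltjes (R s) t := by
  have h1 : ∀ u, Continuous fun s => R s u := fun u =>
    hR.comp (continuous_id.prodMk continuous_const)
  have h2 : Continuous fun s => ∫ u in (0 : ℝ)..t, Real.exp u * R s u :=
    intervalIntegral.continuous_parametric_intervalIntegral_of_continuous'
      (f := fun s u => Real.exp u * R s u) ((Real.continuous_exp.comp continuous_snd).mul hR) 0 t
  exact ((continuous_const.mul (h1 t)).sub (h1 0)).sub h2

theorem expSum_sub (n : ℕ) (t : ℝ) (f g : ℝ → ℝ) :
    expSum n t (fun s => f s - g s) = expSum n t f - expSum n t g := by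
  unfold expSum
  rw [← Finset.sum_sub_distrib]
  exact Finset.sum_congr rfl fun i _ => by ring

theorem tendsto_expSum_expSum {R : ℝ → ℝ → ℝ} (hR : Continuous (Function.uncurry R)) {t : ℝ}
    (ht : 0 ≤ t) :
    Filter.Tendsto (fun n => expSum n t fun s => expSum n t (R s)) Filter.atTop
      (nhds (expStieltjes (fun s => expStieltjes (R s) t) t)) := by
  have hΦ := tendsto_expSum (continuous_expStieltjes hR t) ht
  have hdiff : Filter.Tendsto (fun n => (expSum n t fun s => expSum n t (R s)) -
      expSum n t fun s => expStieltjes (R s) t) Filter.atTop (nhds 0) := by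
    rw [Metric.tendsto_nhds]
    intro ε hε
    have hE : 0 < Real.exp t := Real.exp_pos t
    set η : ℝ := ε / (2 * Real.exp t * Real.exp t) with hη
    have hη0 : 0 < η := by positivity
    have huc : UniformContinuousOn (Function.uncurry R) (Icc 0 t ×ˢ Icc 0 t) :=
      (isCompact_Icc.prod isCompact_Icc).uniformContinuousOn_of_continuous hR.continuousOn
    obtain ⟨δ, hδ, h⟩ := Metric.uniformContinuousOn_iff.1 huc η hη0
    filter_upwards [eventually_mesh_lt t hδ] with n hn
    -- the inner sums converge uniformly in `s`; the outer sum is bounded in the supremum norm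
    have hone : ∀ s ∈ Icc 0 t, |expSum n t (R s) - expStieltjes (R s) t| ≤
        η * (Real.exp t - 1) := by
      intro s hs
      have hRs : Continuous (R s) := hR.comp (continuous_const.prodMk continuous_id)
      refine abs_sum_exp_mul_sub_expStieltjes_le hRs (δ := δ) (n := n + 1)
        (x := fun i => i * (t / (n + 1))) (ξ := fun i => i * (t / (n + 1))) ?_ (by simp)
        (uniform_partition_last t n) fun i _ =>
        ⟨uniform_partition_mem ht n i, (uniform_partition_mesh t n i).trans_lt hn⟩
      intro u hu v hv huv
      have := h (s, u) ⟨hs, hu⟩ (s, v) ⟨hs, hv⟩ (by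
        rw [Prod.dist_eq, dist_self, Real.dist_eq]
        exact max_lt hδ huv)
      exact this.le
    rw [Real.dist_eq, sub_zero, ← expSum_sub]
    refine (abs_sum_exp_mul_sub_le ht hone (n := n + 1)
        (x := fun i => i * (t / (n + 1))) (ξ := fun i => i * (t / (n + 1))) (by simp)
        (uniform_partition_last t n) fun i _ => uniform_partition_mem ht n i).trans_lt ?_
    have : ε = 2 * Real.exp t * (η * Real.exp t) := by
      rw [hη]
      field_simp
    rw [this]
    have : η * (Real.exp t - 1) < η * Real.exp t := by nlinarith
    exact mul_lt_mul_of_pos_left this (by positivity)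
  simpa using hdiff.add hΦ

/-! ### The variance of the exponential integral of fractional Brownian motion -/

theorem expStieltjes_congr {f g : ℝ → ℝ} {t : ℝ} (ht : 0 ≤ t) (h : ∀ s ∈ Icc 0 t, f s = g s) :
    expStieltjes f t = expStieltjes g t := by
  unfold expStieltjes
  rw [h t ⟨ht, le_rfl⟩, h 0 ⟨le_rfl, ht⟩]
  congr 1
  refine intervalIntegral.integral_congr fun s hs => ?_
  rw [uIcc_of_le ht] at hs
  simp only [h s hs]

theorem expStieltjes_affine {f g : ℝ → ℝ} (hf : Continuous f) (hg : Continuous g) (c k l t : ℝ) :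
    expStieltjes (fun s => c + k * f s + l * g s) t =
      k * expStieltjes f t + l * expStieltjes g t := by
  have h0 : Continuous fun s => c * Real.exp s := by fun_prop
  have h1 : Continuous fun s => k * (Real.exp s * f s) := by fun_prop
  have h2 : Continuous fun s => l * (Real.exp s * g s) := by fun_prop
  have h01 : Continuous fun s => c * Real.exp s + k * (Real.exp s * f s) := h0.add h1
  have h : (∫ s in (0 : ℝ)..t, Real.exp s * (c + k * f s + l * g s)) =
      c * (Real.exp t - 1) + k * (∫ s in (0 : ℝ)..t, Real.exp s * f s) +
        l * ∫ s in (0 : ℝ)..t, Real.exp s * g s := by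
    rw [← Real.exp_zero, ← integral_exp, ← intervalIntegral.integral_const_mul,
      ← intervalIntegral.integral_const_mul, ← intervalIntegral.integral_const_mul,
      ← intervalIntegral.integral_add (h0.intervalIntegrable _ _) (h1.intervalIntegrable _ _),
      ← intervalIntegral.integral_add (h01.intervalIntegrable _ _) (h2.intervalIntegrable _ _)]
    refine intervalIntegral.integral_congr fun s _ => ?_
    ring
  unfold expStieltjes
  rw [h]
  ring

theorem integral_exp_mul_abs_sub_rpow {a s t : ℝ} (ha : 0 < a) (hs : s ∈ Icc 0 t) :
    (∫ u in (0 : ℝ)..t, Real.exp u * |s - u| ^ a) =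
      Real.exp s * (∫ r in (0 : ℝ)..s, r ^ a * Real.exp (-r)) +
        Real.exp s * ∫ r in (0 : ℝ)..(t - s), r ^ a * Real.exp r := by
  have hc : Continuous fun u => Real.exp u * |s - u| ^ a :=
    Real.continuous_exp.mul ((continuous_const.sub continuous_id).abs.rpow_const
      fun _ => Or.inr ha.le)
  rw [← intervalIntegral.integral_add_adjacent_intervals
    (hc.intervalIntegrable (μ := volume) 0 s) (hc.intervalIntegrable s t)]
  congr 1
  · have h := intervalIntegral.integral_comp_sub_left
      (fun r => Real.exp s * (r ^ a * Real.exp (-r))) s (a := 0) (b := s)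
    rw [sub_self, sub_zero] at h
    rw [← intervalIntegral.integral_const_mul, ← h]
    refine intervalIntegral.integral_congr fun u hu => ?_
    rw [uIcc_of_le hs.1] at hu
    rw [abs_of_nonneg (sub_nonneg.2 hu.2), neg_sub, Real.exp_sub]
    field_simp
  · have h := intervalIntegral.integral_comp_sub_right
      (fun r => Real.exp s * (r ^ a * Real.exp r)) s (a := s) (b := t)
    rw [sub_self] at h
    rw [← intervalIntegral.integral_const_mul, ← h]
    refine intervalIntegral.integral_congr fun u hu => ?_
    rw [uIcc_of_le hs.2] at hu
    rw [abs_sub_comm, abs_of_nonneg (sub_nonneg.2 hu.1), Real.exp_sub]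
    field_simp

/-- The iterated Stieltjes integral of `|s - u| ^ a` on `[0, t]²`. -/
theorem expStieltjes_abs_sub_rpow {a t : ℝ} (ha : 0 < a) (ht : 0 ≤ t) :
    expStieltjes (fun s => expStieltjes (fun u => |s - u| ^ a) t) t =
      -2 * (Real.exp t * varKernel a t) := by
  have hpc : Continuous fun r : ℝ => r ^ a := Real.continuous_rpow_const ha.le
  have hc1 : Continuous fun r : ℝ => r ^ a * Real.exp (-r) := by fun_prop
  have hc2 : Continuous fun r : ℝ => r ^ a * Real.exp r := by fun_prop
  set P : ℝ → ℝ := fun s => ∫ r in (0 : ℝ)..s, r ^ a * Real.exp (-r) with hP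
  set Q : ℝ → ℝ := fun s => ∫ r in (0 : ℝ)..s, r ^ a * Real.exp r with hQ
  have dP : ∀ s, HasDerivAt P (s ^ a * Real.exp (-s)) s := fun s =>
    intervalIntegral.integral_hasDerivAt_right (hc1.intervalIntegrable _ _)
      hc1.aestronglyMeasurable.stronglyMeasurableAtFilter hc1.continuousAt
  have dQ : ∀ s, HasDerivAt Q (s ^ a * Real.exp s) s := fun s =>
    intervalIntegral.integral_hasDerivAt_right (hc2.intervalIntegrable _ _)
      hc2.aestronglyMeasurable.stronglyMeasurableAtFilter hc2.continuousAt
  have cP : Continuous P := continuous_iff_continuousAt.2 fun s => (dP s).continuousAt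
  have cQ : Continuous Q := continuous_iff_continuousAt.2 fun s => (dQ s).continuousAt
  have P0 : P 0 = 0 := intervalIntegral.integral_same
  have Q0 : Q 0 = 0 := intervalIntegral.integral_same
  have hex : ∀ s, Real.exp s * Real.exp (-s) = 1 := fun s => by rw [← Real.exp_add]; simp
  -- the parts `u < s` and `u > s` of the double integral of `exp (s + u) * |s - u| ^ a` are equal
  have hPint : (∫ s in (0 : ℝ)..t, Real.exp s * (Real.exp s * P s)) =
      (Real.exp t * Real.exp t * P t - Q t) / 2 := by
    have hd : ∀ s ∈ uIcc 0 t, HasDerivAt (fun s => (Real.exp s * Real.exp s * P s - Q s) / 2)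
        (Real.exp s * (Real.exp s * P s)) s := fun s _ => by
      refine (((((Real.hasDerivAt_exp s).mul (Real.hasDerivAt_exp s)).mul (dP s)).sub
        (dQ s)).div_const 2).congr_deriv ?_
      simp only [Pi.mul_apply]
      linear_combination (s ^ a * Real.exp s / 2) * hex s
    rw [intervalIntegral.integral_eq_sub_of_hasDerivAt hd
      ((Real.continuous_exp.mul (Real.continuous_exp.mul cP)).intervalIntegrable _ _)]
    simp [P0, Q0]
  have hQint : (∫ s in (0 : ℝ)..t, Real.exp s * (Real.exp s * Q (t - s))) =
      (Real.exp t * Real.exp t * P t - Q t) / 2 := by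
    have hd : ∀ s ∈ uIcc 0 t, HasDerivAt
        (fun s => Real.exp t * Real.exp t * ((P s - Real.exp (-s) * Real.exp (-s) * Q s) / 2))
        (Real.exp t * Real.exp t * (Real.exp (-s) * Real.exp (-s) * Q s)) s := fun s _ => by
      have he : HasDerivAt (fun s : ℝ => Real.exp (-s)) (-Real.exp (-s)) s := by
        simpa using (hasDerivAt_neg s).exp
      refine ((((dP s).sub ((he.mul he).mul (dQ s))).div_const 2).const_mul
        (Real.exp t * Real.exp t)).congr_deriv ?_
      simp only [Pi.mul_apply]
      linear_combination (-(Real.exp t * Real.exp t * s ^ a * Real.exp (-s) / 2)) * hex s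
    have h := intervalIntegral.integral_comp_sub_left
      (fun s => Real.exp t * Real.exp t * (Real.exp (-s) * Real.exp (-s) * Q s)) t
      (a := 0) (b := t)
    rw [sub_self, sub_zero, intervalIntegral.integral_eq_sub_of_hasDerivAt hd
      (Continuous.intervalIntegrable (by fun_prop) _ _)] at h
    calc _ = _ := intervalIntegral.integral_congr fun s _ => by
          rw [neg_sub, Real.exp_sub]
          field_simp
      _ = _ := h
      _ = _ := by
        simp only [P0, Q0]
        linear_combination (-(Q t * (Real.exp t * Real.exp (-t) + 1) / 2)) * hex t
  have hψ : ∀ s ∈ Icc 0 t, expStieltjes (fun u => |s - u| ^ a) t =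
      Real.exp t * |t - s| ^ a - s ^ a - (Real.exp s * P s + Real.exp s * Q (t - s)) := by
    intro s hs
    unfold expStieltjes
    rw [integral_exp_mul_abs_sub_rpow ha hs]
    simp only [sub_zero, abs_of_nonneg hs.1, abs_sub_comm s t, hP, hQ]
  have c1 : Continuous fun s => Real.exp t * (Real.exp s * |t - s| ^ a) :=
    continuous_const.mul (Real.continuous_exp.mul
      ((continuous_const.sub continuous_id).abs.rpow_const fun _ => Or.inr ha.le))
  have c3 : Continuous fun s => Real.exp s * (Real.exp s * P s) := by fun_prop
  have c4 : Continuous fun s => Real.exp s * (Real.exp s * Q (t - s)) := by fun_prop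
  have hint : (∫ s in (0 : ℝ)..t, Real.exp s *
      (Real.exp t * |t - s| ^ a - s ^ a - (Real.exp s * P s + Real.exp s * Q (t - s)))) =
      Real.exp t * (Real.exp t * P t) - Q t - (Real.exp t * Real.exp t * P t - Q t) := by
    have e1 : (∫ s in (0 : ℝ)..t, Real.exp t * (Real.exp s * |t - s| ^ a)) =
        Real.exp t * (Real.exp t * P t) := by
      rw [intervalIntegral.integral_const_mul, integral_exp_mul_abs_sub_rpow ha ⟨ht, le_rfl⟩]
      simp [hP]
    have c12 : Continuous fun s =>
        Real.exp t * (Real.exp s * |t - s| ^ a) - s ^ a * Real.exp s := c1.sub hc2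
    have c34 : Continuous fun s => Real.exp s * (Real.exp s * P s) +
        Real.exp s * (Real.exp s * Q (t - s)) := c3.add c4
    rw [← e1, show Q t = ∫ s in (0 : ℝ)..t, s ^ a * Real.exp s from rfl,
      ← intervalIntegral.integral_sub (c1.intervalIntegrable _ _) (hc2.intervalIntegrable _ _)]
    have e2 : Real.exp t * Real.exp t * P t - (∫ s in (0 : ℝ)..t, s ^ a * Real.exp s) =
        ∫ s in (0 : ℝ)..t, (Real.exp s * (Real.exp s * P s) +
          Real.exp s * (Real.exp s * Q (t - s))) := by
      rw [intervalIntegral.integral_add (c3.intervalIntegrable _ _) (c4.intervalIntegrable _ _),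
        hPint, hQint]
      simp only [hQ]
      ring
    rw [e2, ← intervalIntegral.integral_sub (c12.intervalIntegrable _ _)
      (c34.intervalIntegrable _ _)]
    refine intervalIntegral.integral_congr fun s _ => ?_
    ring
  rw [expStieltjes_congr ht hψ]
  unfold expStieltjes varKernel
  rw [hint, integral_mul_sinh_eq hpc]
  change _ = -2 * (Real.exp t * (t ^ a + (Real.exp t * P t - Real.exp (-t) * Q t) / 2))
  simp only [sub_self, sub_zero, abs_zero, Real.zero_rpow ha.ne', P0, Q0, abs_of_nonneg ht,
    Real.exp_zero]
  linear_combination (-(Q t)) * hex t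

theorem continuous_fbm_covariance {a : ℝ} (ha : 0 < a) :
    Continuous (Function.uncurry fun s u : ℝ =>
      (1 / 2) * (|s| ^ a + |u| ^ a - |s - u| ^ a)) := by
  have h1 : Continuous fun p : ℝ × ℝ => |p.1| ^ a :=
    continuous_fst.abs.rpow_const fun _ => Or.inr ha.le
  have h2 : Continuous fun p : ℝ × ℝ => |p.2| ^ a :=
    continuous_snd.abs.rpow_const fun _ => Or.inr ha.le
  have h3 : Continuous fun p : ℝ × ℝ => |p.1 - p.2| ^ a :=
    (continuous_fst.sub continuous_snd).abs.rpow_const fun _ => Or.inr ha.le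
  exact continuous_const.mul ((h1.add h2).sub h3)

/-- Stieltjes integrals of constants vanish, so only the term `|s - u| ^ a` of the covariance
contributes to the variance. -/
theorem expStieltjes_fbm_covariance {a t : ℝ} (ha : 0 < a) (ht : 0 ≤ t) :
    expStieltjes (fun s => expStieltjes
      (fun u => (1 / 2) * (|s| ^ a + |u| ^ a - |s - u| ^ a)) t) t =
      Real.exp t * varKernel a t := by
  have h1 : Continuous fun u : ℝ => |u| ^ a := continuous_abs.rpow_const fun _ => Or.inr ha.le
  have h2 : Continuous (Function.uncurry fun s u : ℝ => |s - u| ^ a) :=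
    (continuous_fst.sub continuous_snd).abs.rpow_const fun _ => Or.inr ha.le
  have hin : ∀ s, expStieltjes (fun u => (1 / 2) * (|s| ^ a + |u| ^ a - |s - u| ^ a)) t =
      1 / 2 * expStieltjes (fun u => |u| ^ a) t + 0 * |s| ^ a +
        (-1 / 2) * expStieltjes (fun u => |s - u| ^ a) t := by
    intro s
    have h3 : Continuous fun u : ℝ => |s - u| ^ a :=
      h2.comp (continuous_const.prodMk continuous_id)
    have := expStieltjes_affine h1 h3 (1 / 2 * |s| ^ a) (1 / 2) (-1 / 2) t
    rw [zero_mul, add_zero, ← this]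
    congr 1
    funext u
    ring
  simp_rw [hin]
  rw [expStieltjes_affine h1 (continuous_expStieltjes h2 t), expStieltjes_abs_sub_rpow ha ht]
  ring

/-! ### The law of the exponential integral -/

section Law

variable {Ω : Type*} [MeasurableSpace Ω] {P : Measure Ω} {B : ℝ≥0 → Ω → ℝ} {H : ℝ}

theorem IsFractionalBrownianMotion.isGaussianProcess_path
    (hB : IsFractionalBrownianMotion H B P) :
    IsGaussianProcess (fun (s : ℝ) ω => path B ω s) P :=
  hB.isGaussianProcess.comp_right Real.toNNReal

theorem IsFractionalBrownianMotion.memLp_path (hB : IsFractionalBrownianMotion H B P) (s : ℝ) :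
    MemLp (fun ω => path B ω s) 2 P :=
  (hB.isGaussianProcess_path.hasGaussianLaw_eval s).memLp_two

theorem IsFractionalBrownianMotion.integrable_path_mul_path
    (hB : IsFractionalBrownianMotion H B P) (s u : ℝ) :
    Integrable (fun ω => path B ω s * path B ω u) P :=
  (hB.memLp_path s).integrable_mul (hB.memLp_path u)

theorem ProbabilityTheory.IsGaussianProcess.hasGaussianLaw_expSum {X : ℝ → Ω → ℝ}
    (hX : IsGaussianProcess X P) (n : ℕ) (t : ℝ) :
    HasGaussianLaw (fun ω => expSum n t fun s => X s ω) P := by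
  have hZ : IsGaussianProcess (fun (i : ℕ) ω => Real.exp (i * (t / (n + 1))) *
      (X ((i + 1 : ℕ) * (t / (n + 1))) ω - X (i * (t / (n + 1))) ω)) P := by
    refine hX.of_isGaussianProcess fun i =>
      ⟨{((i + 1 : ℕ) : ℝ) * (t / (n + 1)), (i : ℝ) * (t / (n + 1))},
        Real.exp (i * (t / (n + 1))) •
          (ContinuousLinearMap.proj ⟨((i + 1 : ℕ) : ℝ) * (t / (n + 1)), by simp⟩ -
            ContinuousLinearMap.proj ⟨(i : ℝ) * (t / (n + 1)), by simp⟩), fun ω => ?_⟩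
    simp [Finset.restrict_def]
  exact hZ.hasGaussianLaw_fun_sum

theorem integrable_expSum {F : ℝ → Ω → ℝ} (hF : ∀ s, Integrable (F s) P) (n : ℕ) (t : ℝ) :
    Integrable (fun ω => expSum n t fun s => F s ω) P :=
  integrable_finsetSum _ fun _ _ => ((hF _).sub (hF _)).const_mul _

theorem integral_expSum {F : ℝ → Ω → ℝ} (hF : ∀ s, Integrable (F s) P) (n : ℕ) (t : ℝ) :
    ∫ ω, expSum n t (fun s => F s ω) ∂P = expSum n t fun s => ∫ ω, F s ω ∂P := by
  simp only [expSum]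
  have hs : ∀ s u : ℝ, Integrable (fun ω => F s ω - F u ω) P := fun s u => (hF s).sub (hF u)
  rw [integral_finsetSum _ fun i _ => (hs _ _).const_mul _]
  refine Finset.sum_congr rfl fun i _ => ?_
  rw [integral_const_mul, integral_sub (hF _) (hF _)]

theorem expSum_mul (n : ℕ) (t c : ℝ) (g : ℝ → ℝ) :
    expSum n t (fun s => g s * c) = expSum n t g * c := by
  unfold expSum
  rw [Finset.sum_mul]
  exact Finset.sum_congr rfl fun i _ => by ring

theorem expSum_sq (n : ℕ) (t : ℝ) (g : ℝ → ℝ) :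
    expSum n t g ^ 2 = expSum n t fun s => expSum n t fun u => g s * g u := by
  have h : ∀ s, (expSum n t fun u => g s * g u) = g s * expSum n t g := fun s => by
    rw [mul_comm (g s), ← expSum_mul]
    simp only [mul_comm]
  simp only [h]
  rw [expSum_mul, sq]

theorem expSum_congr {n : ℕ} {t : ℝ} (ht : 0 ≤ t) {f g : ℝ → ℝ} (h : ∀ s, 0 ≤ s → f s = g s) :
    expSum n t f = expSum n t g := by
  unfold expSum
  refine Finset.sum_congr rfl fun i _ => ?_
  rw [h _ (by positivity), h _ (by positivity)]

theorem IsFractionalBrownianMotion.integral_path (hB : IsFractionalBrownianMotion H B P) (s : ℝ) :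
    ∫ ω, path B ω s ∂P = 0 :=
  hB.mean_zero _

/-- The absolute values extend the covariance continuously to the whole plane. -/
theorem IsFractionalBrownianMotion.integral_path_mul_path
    (hB : IsFractionalBrownianMotion H B P) {s u : ℝ} (hs : 0 ≤ s) (hu : 0 ≤ u) :
    ∫ ω, path B ω s * path B ω u ∂P =
      (1 / 2) * (|s| ^ (2 * H) + |u| ^ (2 * H) - |s - u| ^ (2 * H)) := by
  have := hB.covariance s.toNNReal u.toNNReal
  rw [Real.coe_toNNReal s hs, Real.coe_toNNReal u hu] at this
  rw [abs_of_nonneg hs, abs_of_nonneg hu]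
  exact this

theorem IsFractionalBrownianMotion.integral_expSum_sq (hB : IsFractionalBrownianMotion H B P)
    {t : ℝ} (ht : 0 ≤ t) (n : ℕ) :
    ∫ ω, expSum n t (path B ω) ^ 2 ∂P = expSum n t fun s => expSum n t fun u =>
      (1 / 2) * (|s| ^ (2 * H) + |u| ^ (2 * H) - |s - u| ^ (2 * H)) := by
  simp_rw [expSum_sq]
  rw [integral_expSum fun s => integrable_expSum (hB.integrable_path_mul_path s) n t]
  simp_rw [fun s => integral_expSum (hB.integrable_path_mul_path s) n t]
  exact expSum_congr ht fun s hs => expSum_congr ht fun u hu => hB.integral_path_mul_path hs hu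

theorem IsFractionalBrownianMotion.map_expSum [IsProbabilityMeasure P]
    (hB : IsFractionalBrownianMotion H B P) {t : ℝ} (n : ℕ) :
    P.map (fun ω => expSum n t (path B ω)) =
      gaussianReal 0 (∫ ω, expSum n t (path B ω) ^ 2 ∂P).toNNReal := by
  have hG := hB.isGaussianProcess_path.hasGaussianLaw_expSum n t
  have h0 : ∫ ω, expSum n t (path B ω) ∂P = 0 := by
    have := integral_expSum (fun s => (hB.memLp_path s).integrable one_le_two) n t
    simp only [hB.integral_path] at this
    rw [this]
    simp [expSum]
  have h := hG.map_eq_gaussianReal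
  rw [variance_of_integral_eq_zero hG.aemeasurable h0, h0] at h
  exact h

/-- An almost sure limit of centered Gaussian variables whose variances converge is Gaussian
with the limiting variance. -/
theorem map_eq_gaussianReal_of_tendsto [IsProbabilityMeasure P] {Y : ℕ → Ω → ℝ} {X : Ω → ℝ}
    {w : ℕ → ℝ≥0} {v : ℝ≥0} (hYm : ∀ n, AEMeasurable (Y n) P)
    (hY : ∀ n, P.map (Y n) = gaussianReal 0 (w n))
    (hlim : ∀ᵐ ω ∂P, Filter.Tendsto (fun n => Y n ω) Filter.atTop (nhds (X ω)))
    (hw : Filter.Tendsto w Filter.atTop (nhds v)) :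
    AEMeasurable X P ∧ P.map X = gaussianReal 0 v := by
  have hX : AEMeasurable X P := aemeasurable_of_tendsto_metrizable_ae' hYm hlim
  refine ⟨hX, ?_⟩
  have : IsProbabilityMeasure (P.map X) := Measure.isProbabilityMeasure_map hX
  refine Measure.ext_of_charFun (funext fun u => ?_)
  have hcf : ∀ Z : Ω → ℝ, AEMeasurable Z P →
      charFun (P.map Z) u = ∫ ω, Complex.exp (u * Z ω * Complex.I) ∂P := fun Z hZ => by
    rw [charFun_apply_real, integral_map hZ (by fun_prop)]
  have h1 : Filter.Tendsto (fun n => ∫ ω, Complex.exp (u * Y n ω * Complex.I) ∂P) Filter.atTop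
      (nhds (∫ ω, Complex.exp (u * X ω * Complex.I) ∂P)) := by
    refine tendsto_integral_of_dominated_convergence (fun _ => 1) (fun n => ?_)
      (integrable_const 1) (fun n => Filter.Eventually.of_forall fun ω => ?_) ?_
    · have hc : Continuous fun x : ℝ => Complex.exp (u * x * Complex.I) := by fun_prop
      exact (hc.measurable.comp_aemeasurable (hYm n)).aestronglyMeasurable
    · rw [← Complex.ofReal_mul, Complex.norm_exp_ofReal_mul_I]
    · filter_upwards [hlim] with ω hω
      have hc : Continuous fun x : ℝ => Complex.exp (u * x * Complex.I) := by fun_prop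
      exact (hc.tendsto _).comp hω
  have h2 : Filter.Tendsto (fun n => charFun (gaussianReal 0 (w n)) u) Filter.atTop
      (nhds (charFun (gaussianReal 0 v) u)) := by
    simp only [charFun_gaussianReal]
    have hc : Continuous fun x : ℝ≥0 =>
        Complex.exp (u * (0 : ℝ) * Complex.I - ((x : ℝ) : ℂ) * u ^ 2 / 2) := by fun_prop
    exact (hc.tendsto _).comp hw
  rw [hcf X hX]
  refine tendsto_nhds_unique h1 (h2.congr fun n => ?_)
  rw [← hY n, hcf _ (hYm n)]

theorem IsFractionalBrownianMotion.ae_continuous_path (hB : IsFractionalBrownianMotion H B P) :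
    ∀ᵐ ω ∂P, Continuous (path B ω) := by
  filter_upwards [hB.continuous_paths] with ω hω
  exact hω.comp continuous_real_toNNReal

theorem IsFractionalBrownianMotion.ae_hasStieltjesIntegral
    (hB : IsFractionalBrownianMotion H B P) (t : ℝ) :
    ∀ᵐ ω ∂P, HasStieltjesIntegral Real.exp (path B ω) 0 t (expWienerIntegral B t ω) := by
  filter_upwards [hB.ae_continuous_path] with ω hω
  exact hasStieltjesIntegral_stieltjesIntegral hω t

theorem IsFractionalBrownianMotion.map_expWienerIntegral [IsProbabilityMeasure P]
    (hB : IsFractionalBrownianMotion H B P) (hH : 0 < H) {t : ℝ} (ht : 0 ≤ t) :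
    AEMeasurable (expWienerIntegral B t) P ∧ P.map (expWienerIntegral B t) =
      gaussianReal 0 (Real.exp t * varKernel (2 * H) t).toNNReal := by
  have ha : 0 < 2 * H := by positivity
  refine map_eq_gaussianReal_of_tendsto
    (fun n => (hB.isGaussianProcess_path.hasGaussianLaw_expSum n t).aemeasurable)
    (fun n => hB.map_expSum n) ?_ ?_
  · filter_upwards [hB.ae_hasStieltjesIntegral t] with ω hω
    exact hω.tendsto_expSum ht
  · refine (continuous_real_toNNReal.tendsto _).comp ?_
    simp_rw [hB.integral_expSum_sq ht]
    rw [← expStieltjes_fbm_covariance ha ht]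
    exact tendsto_expSum_expSum (continuous_fbm_covariance ha) ht

/-! ### Second moment and entropy of Gaussian variables -/

variable {X : Ω → ℝ} {v : ℝ≥0}

theorem memLp_two_of_map_eq_gaussianReal (hX : AEMeasurable X P)
    (h : P.map X = gaussianReal 0 v) : MemLp X 2 P := by
  have := memLp_id_gaussianReal (μ := 0) (v := v) 2
  rw [← h] at this
  exact (memLp_map_measure_iff (by fun_prop) hX).1 this

theorem integral_sq_gaussianReal (v : ℝ≥0) : ∫ x, x ^ 2 ∂gaussianReal 0 v = v := by
  have := variance_of_integral_eq_zero (μ := gaussianReal 0 v) (X := fun x => x) (by fun_prop)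
    integral_id_gaussianReal
  rw [← this, variance_fun_id_gaussianReal]

theorem secondMoment_of_map_eq_gaussianReal (hX : AEMeasurable X P)
    (h : P.map X = gaussianReal 0 v) : secondMoment P X = v := by
  rw [← integral_sq_gaussianReal v, ← h, integral_map hX (by fun_prop)]
  rfl

theorem lawDensity_ae_eq (h : P.map X = gaussianReal 0 v) :
    lawDensity P X =ᵐ[volume] gaussianPDFReal 0 v := by
  filter_upwards [rnDeriv_gaussianReal 0 v] with x hx
  rw [lawDensity, h, hx, toReal_gaussianPDF]

theorem gaussianPDFReal_mul_log (hv : v ≠ 0) (x : ℝ) :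
    gaussianPDFReal 0 v x * Real.log (gaussianPDFReal 0 v x) =
      -(Real.log (2 * Real.pi * v) / 2) * gaussianPDFReal 0 v x -
        1 / (2 * v) * (gaussianPDFReal 0 v x * x ^ 2) := by
  have hv0 : (0 : ℝ) < v := NNReal.coe_pos.2 (pos_iff_ne_zero.2 hv)
  have h2 : (0 : ℝ) < 2 * Real.pi * v := by positivity
  have hlog : Real.log (gaussianPDFReal 0 v x) =
      -(Real.log (2 * Real.pi * v) / 2) - 1 / (2 * v) * x ^ 2 := by
    rw [gaussianPDFReal_def, Real.log_mul (inv_ne_zero (Real.sqrt_ne_zero'.2 h2))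
      (Real.exp_ne_zero _), Real.log_inv, Real.log_exp, Real.log_sqrt h2.le]
    ring
  rw [hlog]
  ring

theorem integrable_gaussianPDFReal_mul_sq (hv : v ≠ 0) :
    Integrable fun x => gaussianPDFReal 0 v x * x ^ 2 := by
  have h : Integrable (fun x : ℝ => x ^ 2) (gaussianReal 0 v) :=
    (memLp_id_gaussianReal (μ := 0) (v := v) 2).integrable_sq
  rw [gaussianReal_of_var_ne_zero _ hv, integrable_withDensity_iff_integrable_smul'
    (measurable_gaussianPDF 0 v) (Filter.Eventually.of_forall fun _ => gaussianPDF_lt_top)] at h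
  simpa only [toReal_gaussianPDF, smul_eq_mul] using h

theorem integrable_lawDensity_mul_log (hv : v ≠ 0) (h : P.map X = gaussianReal 0 v) :
    Integrable fun x => lawDensity P X x * Real.log (lawDensity P X x) := by
  have : Integrable fun x => gaussianPDFReal 0 v x * Real.log (gaussianPDFReal 0 v x) := by
    simp_rw [gaussianPDFReal_mul_log hv]
    exact ((integrable_gaussianPDFReal 0 v).const_mul _).sub
      ((integrable_gaussianPDFReal_mul_sq hv).const_mul _)
  refine this.congr ?_
  filter_upwards [lawDensity_ae_eq h] with x hx
  rw [hx]

theorem shannonEntropy_of_map_eq_gaussianReal (hv : v ≠ 0) (h : P.map X = gaussianReal 0 v) :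
    shannonEntropy P X = Real.log (2 * Real.pi * v) / 2 + 1 / 2 := by
  have hsq : ∫ x, gaussianPDFReal 0 v x * x ^ 2 = v := by
    rw [← integral_sq_gaussianReal v, integral_gaussianReal_eq_integral_smul hv]
    rfl
  have hv0 : (v : ℝ) ≠ 0 := NNReal.coe_ne_zero.2 hv
  have hcongr : shannonEntropy P X =
      ∫ x, -(gaussianPDFReal 0 v x * Real.log (gaussianPDFReal 0 v x)) := by
    refine integral_congr_ae ?_
    filter_upwards [lawDensity_ae_eq h] with x hx
    rw [hx]
  rw [hcongr, integral_neg]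
  simp_rw [gaussianPDFReal_mul_log hv]
  rw [integral_sub ((integrable_gaussianPDFReal 0 v).const_mul _)
    ((integrable_gaussianPDFReal_mul_sq hv).const_mul _), integral_const_mul, integral_const_mul,
    integral_gaussianPDFReal_eq_one 0 hv, hsq]
  field_simp
  ring

end Law

/-- Both functionals of the theorem are strictly increasing functions `φ` of the variance. -/
theorem exists_strictMonoOn_variance {Ω : ℝ → Type*} [∀ H, MeasurableSpace (Ω H)]
    {P : ∀ H, Measure (Ω H)} [∀ H, IsProbabilityMeasure (P H)] {B : ∀ H, ℝ≥0 → Ω H → ℝ}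
    (hB : ∀ H ∈ Icc (1 / 2 : ℝ) 1, IsFractionalBrownianMotion H (B H) (P H)) {F : ℝ → ℝ → ℝ}
    (hF : (F = fun H t => secondMoment (P H) (expWienerIntegral (B H) t)) ∨
      (F = fun H t => shannonEntropy (P H) (expWienerIntegral (B H) t))) :
    ∃ φ : ℝ → ℝ, StrictMonoOn φ (Ioi 0) ∧ ∀ H ∈ Icc (1 / 2 : ℝ) 1, ∀ t > 0,
      F H t = φ (Real.exp t * varKernel (2 * H) t) := by
  have hpos : ∀ H t : ℝ, 0 < t → 0 < Real.exp t * varKernel (2 * H) t := fun H t ht =>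
    mul_pos (Real.exp_pos t) (varKernel_pos ht)
  rcases hF with rfl | rfl
  · refine ⟨id, strictMonoOn_id, fun H hH t ht => ?_⟩
    obtain ⟨hm, hl⟩ := (hB H hH).map_expWienerIntegral (by linarith [hH.1]) ht.le
    simp only [secondMoment_of_map_eq_gaussianReal hm hl, id]
    exact Real.coe_toNNReal _ (hpos H t ht).le
  · refine ⟨fun v => Real.log (2 * Real.pi * v) / 2 + 1 / 2, fun v hv w hw hvw => ?_,
      fun H hH t ht => ?_⟩
    · have hp := Real.pi_pos
      have hv : 0 < v := hv
      have := Real.log_lt_log (x := 2 * Real.pi * v) (y := 2 * Real.pi * w) (by positivity)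
        (mul_lt_mul_of_pos_left hvw (by positivity))
      simp only
      linarith
    · obtain ⟨hm, hl⟩ := (hB H hH).map_expWienerIntegral (by linarith [hH.1]) ht.le
      simp only
      rw [shannonEntropy_of_map_eq_gaussianReal (Real.toNNReal_pos.2 (hpos H t ht)).ne' hl,
        Real.coe_toNNReal _ (hpos H t ht).le]

/-! ### Dependence on the Hurst index -/

theorem theorem3p2 :
    ∃ (τ₁ τ₂ : ℝ) (h : ℝ → ℝ),
      1 < τ₁ ∧ τ₁ < Real.log 3 ∧ Real.log 3 < τ₂ ∧
      (∀ t ∈ Ioo τ₁ τ₂, 1 / 2 < h t ∧ h t < 1) ∧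
      -- for every choice of fractional Brownian motions `B H`, `1/2 ≤ H ≤ 1`,
      -- possibly on different probability spaces
      ∀ (Ω : ℝ → Type*) [∀ H, MeasurableSpace (Ω H)] (P : ∀ H, Measure (Ω H))
        [∀ H, IsProbabilityMeasure (P H)] (B : ∀ H, ℝ≥0 → Ω H → ℝ),
        (∀ H ∈ Icc (1 / 2 : ℝ) 1, IsFractionalBrownianMotion H (B H) (P H)) →
        -- the integral, its second moment and its entropy are well defined
        (∀ H ∈ Icc (1 / 2 : ℝ) 1, ∀ t > 0,
          (∀ᵐ ω ∂P H, HasStieltjesIntegral Real.exp (path (B H) ω) 0 t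
            (expWienerIntegral (B H) t ω)) ∧
          MemLp (expWienerIntegral (B H) t) 2 (P H) ∧
          (P H).map (expWienerIntegral (B H) t) ≪ volume ∧
          Integrable (fun x => lawDensity (P H) (expWienerIntegral (B H) t) x *
            Real.log (lawDensity (P H) (expWienerIntegral (B H) t) x))) ∧
        -- `F` is the second moment or the Shannon entropy, as a function of `H` and `t`
        ∀ F : ℝ → ℝ → ℝ,
          ((F = fun H t => secondMoment (P H) (expWienerIntegral (B H) t)) ∨
            (F = fun H t => shannonEntropy (P H) (expWienerIntegral (B H) t))) →
          (∀ t ∈ Ioc 0 τ₁, StrictAntiOn (fun H => F H t) (Icc (1 / 2) 1)) ∧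
          (∀ t ∈ Ioo τ₁ (Real.log 3),
            StrictAntiOn (fun H => F H t) (Icc (1 / 2) (h t)) ∧
            StrictMonoOn (fun H => F H t) (Icc (h t) 1) ∧
            F 1 t < F (1 / 2) t) ∧
          (StrictAntiOn (fun H => F H (Real.log 3)) (Icc (1 / 2) (h (Real.log 3))) ∧
            StrictMonoOn (fun H => F H (Real.log 3)) (Icc (h (Real.log 3)) 1) ∧
            F 1 (Real.log 3) = F (1 / 2) (Real.log 3)) ∧
          (∀ t ∈ Ioo (Real.log 3) τ₂,
            StrictAntiOn (fun H => F H t) (Icc (1 / 2) (h t)) ∧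
            StrictMonoOn (fun H => F H t) (Icc (h t) 1) ∧
            F (1 / 2) t < F 1 t) ∧
          (∀ t ≥ τ₂, StrictMonoOn (fun H => F H t) (Icc (1 / 2) 1)) := by
  obtain ⟨τ₁, ⟨h1τ, hτ3⟩, hneg₁, hzero₁, hpos₁⟩ := exists_sign_change_varSlope_two
  obtain ⟨τ₂, h3τ, hneg₂, hzero₂, hpos₂⟩ := exists_sign_change_varSlope_one
  have hτ0 : 0 < τ₁ := one_pos.trans h1τ
  have hlog0 : 0 < Real.log 3 := hτ0.trans hτ3
  have hex : ∀ t, ∃ c, t ∈ Ioo τ₁ τ₂ → c ∈ Ioo (1 : ℝ) 2 ∧ varSlope c t = 0 := by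
    intro t
    by_cases ht : t ∈ Ioo τ₁ τ₂
    · have ht0 : 0 < t := hτ0.trans ht.1
      obtain ⟨c, hc⟩ := exists_varSlope_eq_zero ht0 (hneg₂ t ht0 ht.2) (hpos₁ t ht.1)
      exact ⟨c, fun _ => hc⟩
    · exact ⟨0, fun h => absurd h ht⟩
  choose c hc using hex
  refine ⟨τ₁, τ₂, fun t => c t / 2, h1τ, hτ3, h3τ, fun t ht => ?_, ?_⟩
  · have := (hc t ht).1
    exact ⟨by linarith [this.1], by linarith [this.2]⟩
  intro Ω _ P _ B hB
  refine ⟨fun H hH t ht => ?_, fun F hF => ?_⟩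
  · have hH0 : 0 < H := by linarith [hH.1]
    obtain ⟨hm, hl⟩ := (hB H hH).map_expWienerIntegral hH0 ht.le
    have hv : (Real.exp t * varKernel (2 * H) t).toNNReal ≠ 0 :=
      (Real.toNNReal_pos.2 (mul_pos (Real.exp_pos t) (varKernel_pos ht))).ne'
    refine ⟨(hB H hH).ae_hasStieltjesIntegral t, memLp_two_of_map_eq_gaussianReal hm hl, ?_,
      integrable_lawDensity_mul_log hv hl⟩
    rw [hl]
    exact gaussianReal_absolutelyContinuous 0 hv
  obtain ⟨φ, hφ, hFφ⟩ := exists_strictMonoOn_variance hB hF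
  have hmem : ∀ a t : ℝ, 0 < t → Real.exp t * varKernel a t ∈ Ioi (0 : ℝ) := fun a t ht =>
    mul_pos (Real.exp_pos t) (varKernel_pos ht)
  have hlt : ∀ H ∈ Icc (1 / 2 : ℝ) 1, ∀ K ∈ Icc (1 / 2 : ℝ) 1, ∀ t > 0,
      varKernel (2 * H) t < varKernel (2 * K) t → F H t < F K t := by
    intro H hH K hK t ht hHK
    rw [hFφ H hH t ht, hFφ K hK t ht]
    exact hφ (hmem _ t ht) (hmem _ t ht) (mul_lt_mul_of_pos_left hHK (Real.exp_pos t))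
  have hanti : ∀ t > 0, ∀ b ≤ (2 : ℝ), varSlope b t ≤ 0 →
      StrictAntiOn (fun H => F H t) (Icc (1 / 2) (b / 2)) := by
    intro t ht b hb hs x hx y hy hxy
    exact hlt y ⟨hy.1, by linarith [hy.2]⟩ x ⟨hx.1, by linarith [hx.2]⟩ t ht
      (varKernel_strictAntiOn one_pos ht hs ⟨by linarith [hx.1], by linarith [hx.2]⟩
        ⟨by linarith [hy.1], by linarith [hy.2]⟩ (by linarith))
  have hmono : ∀ t > 0, ∀ b ≥ (1 : ℝ), 0 ≤ varSlope b t →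
      StrictMonoOn (fun H => F H t) (Icc (b / 2) 1) := by
    intro t ht b hb hs x hx y hy hxy
    exact hlt x ⟨by linarith [hx.1], hx.2⟩ y ⟨by linarith [hy.1], hy.2⟩ t ht
      (varKernel_strictMonoOn (b := 2) (by linarith) ht hs
        ⟨by linarith [hx.1], by linarith [hx.2]⟩ ⟨by linarith [hy.1], by linarith [hy.2]⟩
        (by linarith))
  have hmid : ∀ t ∈ Ioo τ₁ τ₂, StrictAntiOn (fun H => F H t) (Icc (1 / 2) (c t / 2)) ∧
      StrictMonoOn (fun H => F H t) (Icc (c t / 2) 1) := fun t ht =>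
    ⟨hanti t (hτ0.trans ht.1) _ (hc t ht).1.2.le (hc t ht).2.le,
      hmono t (hτ0.trans ht.1) _ (hc t ht).1.1.le (hc t ht).2.ge⟩
  have hhalf : (1 / 2 : ℝ) ∈ Icc (1 / 2 : ℝ) 1 := ⟨le_rfl, by norm_num⟩
  have hone : (1 : ℝ) ∈ Icc (1 / 2 : ℝ) 1 := ⟨by norm_num, le_rfl⟩
  have e1 : (2 : ℝ) * (1 / 2) = 1 := by norm_num
  refine ⟨fun t ht => ?_, fun t ht => ?_, ?_, fun t ht => ?_, fun t ht => ?_⟩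
  · have hs : varSlope 2 t ≤ 0 := by
      rcases ht.2.eq_or_lt with rfl | h
      · exact hzero₁.le
      · exact (hneg₁ t ht.1 h).le
    simpa using hanti t ht.1 2 le_rfl hs
  · have ht0 : 0 < t := hτ0.trans ht.1
    obtain ⟨ha, hm⟩ := hmid t ⟨ht.1, ht.2.trans h3τ⟩
    refine ⟨ha, hm, hlt 1 hone (1 / 2) hhalf t ht0 ?_⟩
    rw [e1, mul_one, ← sub_neg, varKernel_two_sub_one]
    have h3 : Real.exp t < 3 := (Real.lt_log_iff_exp_lt (by norm_num)).1 ht.2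
    exact div_neg_of_neg_of_pos (mul_neg_of_pos_of_neg (sub_pos.2 (Real.one_lt_exp_iff.2 ht0))
      (sub_neg.2 h3)) (by positivity)
  · obtain ⟨ha, hm⟩ := hmid (Real.log 3) ⟨hτ3, h3τ⟩
    refine ⟨ha, hm, ?_⟩
    have h := varKernel_two_sub_one (Real.log 3)
    rw [Real.exp_log (by norm_num), sub_self, mul_zero, zero_div, sub_eq_zero] at h
    rw [hFφ 1 hone _ hlog0, hFφ (1 / 2) hhalf _ hlog0, e1, mul_one, h]
  · have ht0 : 0 < t := hlog0.trans ht.1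
    obtain ⟨ha, hm⟩ := hmid t ⟨hτ3.trans ht.1, ht.2⟩
    refine ⟨ha, hm, hlt (1 / 2) hhalf 1 hone t ht0 ?_⟩
    rw [e1, mul_one, ← sub_pos, varKernel_two_sub_one]
    have h3 : 3 < Real.exp t := (Real.log_lt_iff_lt_exp (by norm_num)).1 ht.1
    exact div_pos (mul_pos (sub_pos.2 (Real.one_lt_exp_iff.2 ht0)) (sub_pos.2 h3))
      (by positivity)
  · have ht0 : 0 < t := (hlog0.trans h3τ).trans_le ht
    have hs : 0 ≤ varSlope 1 t := by
      rcases (show τ₂ ≤ t from ht).eq_or_lt with rfl | h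
      · exact hzero₂.ge
      · exact (hpos₂ t h).le
    exact hmono t ht0 1 le_rfl hs
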